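/- Let $\mathbb{F}_q$ be a finite field of odd characteristic and let $K$ be a global function field with full field of constants $\mathbb{F}_q$ (that is, $K$ is a finite extension of $\mathbb{F}_q(t)$ in which $\mathbb{F}_q$ is algebraically closed). Let $X$ be the set of places of $K$ (classes of discrete valuations on $K$), with normalized valuations $\operatorname{ord}_{\mathfrak r}$ and degrees taken over $\mathbb{F}_q$. Let $\operatorname{Pic}^0X$ be the group of divisors of degree $0$ modulo principal divisors, and for a divisor $\mathcal D$ let $\mathcal L(\mathcal D)=\{f\in K^\times : \operatorname{div} f\ge -\mathcal D\}\cup\{0\}$. A nonzero element of $K$ is called singular if its valuation at every place of $K$ is even. Then $\operatorname{Pic}^0X$ is finite, $\mathbb{F}_q$ contains a non-square, and for any two places $\mathfrak p,\mathfrak q\in X$ of equal degree the following hold. (a) There is an integer $j\ge 1$ with $\mathcal L(j\mathfrak p-j\mathfrak q)\ne 0$. For the least such integer $k$, the $\mathbb{F}_q$-vector space $\mathcal L(k\mathfrak p-k\mathfrak q)$ has dimension $1$, and every generator $\beta$ of it has divisor exactly $k\mathfrak q-k\mathfrak p$. If $k$ is even, then every such $\beta$ is a singular element of $K$. (b) Consider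 the algorithm which, having picked $\mathfrak p,\mathfrak q$, computes this $k$, outputs a generator of $\mathcal L(k\mathfrak p-k\mathfrak q)$ if $k$ is even, and outputs at random either $1$ or a non-square constant $\zeta\in\mathbb{F}_q^\times$ if $k$ is odd. It always has an output, and every possible output is a singular element of $K$. -/

import Mathlib

noncomputable section

namespace GlobalFunctionField

/-- A point of the curve attached to `K`: a class of discrete valuations on `K`, represented by
its valuation ring, a subring of `K` that is a discrete valuation ring with fraction field `K`. -/
structure Place (K : Type*) [Field K] where
  /-- The valuation ring. -/
  ring : ValuationSubring K
  /-- The valuation ring is discrete (in particular it is not all of `K`). -/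
  isDVR : IsDiscreteValuationRing ring

attribute [instance] Place.isDVR

namespace Place

variable {K : Type*} [Field K]

/-- The multiplicative valuation of `K` at the place `P`; a uniformizer has value `exp (-1)`. -/
def valuation (P : Place K) : Valuation K (WithZero (Multiplicative ℤ)) :=
  (IsDiscreteValuationRing.maximalIdeal P.ring).valuation K

/-- The normalized additive valuation `ord_P` on the nonzero elements of `K`
(the value at `0` is the junk value `0`). -/
def ord (P : Place K) (f : K) : ℤ := -WithZero.log (P.valuation f)

theorem valuation_ne_zero (P : Place K) {f : K} (hf : f ≠ 0) : P.valuation f ≠ 0 :=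
  (Valuation.ne_zero_iff _).2 hf

theorem ord_one (P : Place K) : P.ord 1 = 0 := by simp [ord]

theorem ord_mul (P : Place K) {f g : K} (hf : f ≠ 0) (hg : g ≠ 0) :
    P.ord (f * g) = P.ord f + P.ord g := by
  simp only [ord, map_mul, WithZero.log_mul (P.valuation_ne_zero hf) (P.valuation_ne_zero hg)]
  ring

theorem ord_inv (P : Place K) (f : K) : P.ord f⁻¹ = -P.ord f := by
  simp only [ord, map_inv₀, WithZero.log_inv]

theorem min_le_ord_add (P : Place K) {f g : K} (hf : f ≠ 0) (hg : g ≠ 0) (hfg : f + g ≠ 0) :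
    min (P.ord f) (P.ord g) ≤ P.ord (f + g) := by
  have hf' := P.valuation_ne_zero hf
  have hg' := P.valuation_ne_zero hg
  have hfg' := P.valuation_ne_zero hfg
  have h := P.valuation.map_add f g
  unfold ord
  rcases le_max_iff.1 h with h | h
  · exact (min_le_left _ _).trans (neg_le_neg ((WithZero.log_le_log hfg' hf').2 h))
  · exact (min_le_right _ _).trans (neg_le_neg ((WithZero.log_le_log hfg' hg').2 h))

variable (F : Type*) [Field F] [Finite F] [Algebra F K]

theorem algebraMap_mem_ring (P : Place K) (c : F) : algebraMap F K c ∈ P.ring :=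
  (P.ring.valuation_le_one_iff _).1 (FiniteField.valuation_algebraMap_le_one _ c)

/-- The inclusion of the finite field of constants into the valuation ring of a place. -/
def constants (P : Place K) : F →+* P.ring :=
  (algebraMap F K).codRestrict P.ring (P.algebraMap_mem_ring F)

/-- The degree of a place: the degree of its residue field over the field of constants. -/
def degree (P : Place K) : ℕ :=
  letI : Algebra F P.ring := (P.constants F).toAlgebra
  Module.finrank F (IsLocalRing.ResidueField P.ring)

theorem ord_algebraMap (P : Place K) (c : F) : P.ord (algebraMap F K c) = 0 := by
  by_cases hc : c = 0
  · simp [hc, ord]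
  · simp [ord, FiniteField.valuation_algebraMap_eq_one P.valuation c hc]

end Place

/-- The group of divisors: finite formal integer combinations of places, with the coefficientwise
partial order. The prime divisor of `P` is `Finsupp.single P 1`. -/
abbrev Divisor (K : Type*) [Field K] := Place K →₀ ℤ

/-- The prime divisor of a place. -/
abbrev Place.toDivisor {K : Type*} [Field K] (P : Place K) : Divisor K := Finsupp.single P 1

section

variable {K : Type*} [Field K]

/-- `D` is the divisor of the nonzero element `f` of `K`. -/
def HasDivisor (f : K) (D : Divisor K) : Prop :=
  f ≠ 0 ∧ ∀ P : Place K, P.ord f = D P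

/-- `f` is a singular element of `K`: it is nonzero with even valuation at every place. -/
def IsSingular (f : K) : Prop :=
  f ≠ 0 ∧ ∀ P : Place K, Even (P.ord f)

variable (K) in
/-- The group of principal divisors, the divisors of nonzero elements of `K`. -/
def principalDivisors : AddSubgroup (Divisor K) where
  carrier := {D | ∃ f : K, HasDivisor f D}
  zero_mem' := ⟨1, one_ne_zero, fun P => by simp [P.ord_one]⟩
  add_mem' := by
    rintro D E ⟨f, hf, hD⟩ ⟨g, hg, hE⟩
    exact ⟨f * g, mul_ne_zero hf hg, fun P => by simp [P.ord_mul hf hg, hD, hE]⟩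
  neg_mem' := by
    rintro D ⟨f, hf, hD⟩
    exact ⟨f⁻¹, inv_ne_zero hf, fun P => by simp [P.ord_inv, hD]⟩

variable (K) in
/-- The Picard group: divisors modulo principal divisors. -/
abbrev Pic := Divisor K ⧸ principalDivisors K

variable (F : Type*) [Field F] [Finite F] [Algebra F K]

/-- The degree of a divisor, `∑ n_P P ↦ ∑ n_P deg P`. -/
def divisorDegree : Divisor K →+ ℤ :=
  Finsupp.liftAddHom fun P => AddMonoidHom.mulRight (P.degree F : ℤ)

/-- `Pic⁰`: the subgroup of `Pic` of the classes of divisors of degree zero. -/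
def Pic0 (F K : Type*) [Field F] [Finite F] [Field K] [Algebra F K] : AddSubgroup (Pic K) :=
  (divisorDegree (K := K) F).ker.map (QuotientAddGroup.mk' (principalDivisors K))

/-- The Riemann-Roch space `L(D) = {f ≠ 0 | div f ≥ -D} ∪ {0}`. -/
def riemannRochSpace (D : Divisor K) : Submodule F K where
  carrier := {f | f ≠ 0 → ∀ P : Place K, -D P ≤ P.ord f}
  zero_mem' := fun h => (h rfl).elim
  add_mem' := by
    intro f g hf hg hfg P
    by_cases hf0 : f = 0
    · subst hf0
      rw [zero_add] at hfg ⊢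
      exact hg hfg P
    by_cases hg0 : g = 0
    · subst hg0
      rw [add_zero] at hfg ⊢
      exact hf hfg P
    exact (le_min (hf hf0 P) (hg hg0 P)).trans (P.min_le_ord_add hf0 hg0 hfg)
  smul_mem' := by
    intro c f hf hcf P
    rw [Algebra.smul_def] at hcf ⊢
    have hc := left_ne_zero_of_mul hcf
    have hf0 := right_ne_zero_of_mul hcf
    rw [P.ord_mul hc hf0, P.ord_algebraMap F c, zero_add]
    exact hf hf0 P

/-- `β` generates the `F`-vector space `L(D)`. -/
def GeneratesRR (D : Divisor K) (β : K) : Prop :=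
  Submodule.span F {β} = riemannRochSpace F D

/-- `k` is the least positive integer `j` with `L(j p - j q) ≠ 0`. -/
def IsMinExponent (p q : Place K) (k : ℕ) : Prop :=
  IsLeast {j : ℕ | 1 ≤ j ∧ riemannRochSpace F (j • p.toDivisor - j • q.toDivisor) ≠ ⊥} k

/-- `LasVegasOutput F p q β`: a run of the Las Vegas algorithm that has picked the places `p`, `q`
can output `β`. With `k` the least positive integer such that `L(k p - k q) ≠ 0`, the output is
a generator of this space if `k` is even; otherwise it is, at random, either a non-square constant
`ζ` or `1`. -/
inductive LasVegasOutput (p q : Place K) : K → Prop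
  | generator (k : ℕ) (hk : IsMinExponent F p q k) (hev : Even k) (β : K)
      (hβ : GeneratesRR F (k • p.toDivisor - k • q.toDivisor) β) : LasVegasOutput p q β
  | nonsquare (k : ℕ) (hk : IsMinExponent F p q k) (hodd : ¬ Even k) (ζ : F)
      (hζ : ¬ IsSquare ζ) : LasVegasOutput p q (algebraMap F K ζ)
  | one (k : ℕ) (hk : IsMinExponent F p q k) (hodd : ¬ Even k) : LasVegasOutput p q 1

end

end GlobalFunctionField

end

/-! The heart is the finiteness of Pic⁰. It makes the class of q - p torsion, so some n(q - p) with
n ≥ 1 is principal and L(np - nq) ≠ 0. If deg D = 0 and 0 ≠ f ∈ L(D), then D + div f is effective of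
degree 0, hence zero; so div f = -D, and two such f differ by a function without poles, a constant.
The generator for the least k thus has divisor k(q - p), which is even when k is.

Two facts about x transcendental over F carry the rest. First, elements of an F[x]-module M ⊆ K that
are independent modulo xM are independent over F(x) (`linearIndependent_adjoin_of_mod`). This makes
nontrivial valuation rings discrete, so that functions without poles are constant, and with weak
approximation it bounds the degree of the zeros of x by [K : F(x)]. Second, the products of powers
of x with a basis of K over F(x) give a lower bound for dim L(lB), where B is the pole divisor of x.
Together they give deg B = [K : F(x)], degree zero for principal divisors, and Riemann's inequality.
By the latter every class of degree 0 is E - D₀ with D₀ fixed and E effective of fixed degree, and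
there are finitely many such E. -/

noncomputable section

namespace GlobalFunctionField

/-! ### Orders at places and weak approximation -/

namespace Place
variable {K : Type*} [Field K]

theorem ord_nonneg_iff (P : Place K) {f : K} (hf : f ≠ 0) : 0 ≤ P.ord f ↔ f ∈ P.ring := by
  have h1 : 0 ≤ P.ord f ↔ P.valuation f ≤ 1 := by
    rw [ord, neg_nonneg, ← WithZero.log_one,
      WithZero.log_le_log (P.valuation_ne_zero hf) one_ne_zero]
  rw [h1]
  constructor
  · intro h
    by_contra hmem
    have hinv : f⁻¹ ∈ P.ring := (P.ring.mem_or_inv_mem f).resolve_left hmem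
    have hlt : P.valuation (algebraMap P.ring K ⟨f⁻¹, hinv⟩) < 1 := by
      rw [valuation, IsDedekindDomain.HeightOneSpectrum.valuation_lt_one_iff_mem]
      change _ ∈ IsLocalRing.maximalIdeal P.ring
      rw [IsLocalRing.mem_maximalIdeal, mem_nonunits_iff]
      intro hu
      obtain ⟨u, hu⟩ := hu.exists_right_inv
      have : f⁻¹ * (u : K) = 1 := congrArg Subtype.val hu
      apply hmem
      have hfu : f = u := by field_simp at this; exact this.symm
      rw [hfu]; exact u.2
    have : P.valuation f⁻¹ < 1 := hlt
    rw [map_inv₀] at this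
    have h0 : 0 < P.valuation f := zero_lt_iff.2 (P.valuation_ne_zero hf)
    exact absurd h (not_le.2 ((inv_lt_one₀ h0).1 this))
  · intro h
    exact IsDedekindDomain.HeightOneSpectrum.valuation_le_one _ (⟨f, h⟩ : P.ring)

theorem ord_pos_iff (P : Place K) {f : K} (hf : f ≠ 0) : 0 < P.ord f ↔ f⁻¹ ∉ P.ring := by
  rw [← P.ord_nonneg_iff (inv_ne_zero hf), ord_inv]; omega

theorem ord_coe_pos_iff (P : Place K) {f : P.ring} (hf : (f : K) ≠ 0) :
    0 < P.ord (f : K) ↔ f ∈ IsLocalRing.maximalIdeal P.ring := by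
  rw [P.ord_pos_iff hf, IsLocalRing.mem_maximalIdeal, mem_nonunits_iff, not_iff_not]
  constructor
  · intro h
    exact IsUnit.of_mul_eq_one ⟨_, h⟩ (Subtype.ext (mul_inv_cancel₀ hf))
  · intro h
    obtain ⟨u, hu⟩ := h.exists_right_inv
    have h1 : (f : K) * (u : K) = 1 := congrArg Subtype.val hu
    rw [inv_eq_of_mul_eq_one_right h1]
    exact u.2

theorem exists_ord_eq_one (P : Place K) : ∃ u : K, u ≠ 0 ∧ P.ord u = 1 := by
  obtain ⟨u, hu⟩ :=
    (IsDiscreteValuationRing.maximalIdeal P.ring).valuation_exists_uniformizer K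
  have hu' : P.valuation u = WithZero.exp (-1) := hu
  refine ⟨u, ?_, by rw [ord, hu']; simp⟩
  rintro rfl
  rw [map_zero] at hu'
  exact WithZero.exp_ne_zero hu'.symm

theorem ord_pow (P : Place K) {f : K} (hf : f ≠ 0) (n : ℕ) : P.ord (f ^ n) = n * P.ord f := by
  induction n with
  | zero => simp [P.ord_one]
  | succ n ih => rw [pow_succ, P.ord_mul (pow_ne_zero _ hf) hf, ih]; push_cast; ring

theorem ord_zpow (P : Place K) {f : K} (hf : f ≠ 0) (n : ℤ) : P.ord (f ^ n) = n * P.ord f := by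
  cases n with
  | ofNat n => simpa using P.ord_pow hf n
  | negSucc n => rw [zpow_negSucc, ord_inv, P.ord_pow hf, Int.negSucc_eq]; push_cast; ring

theorem exists_ord_eq (P : Place K) (n : ℤ) : ∃ u : K, u ≠ 0 ∧ P.ord u = n := by
  obtain ⟨u, hu, h⟩ := P.exists_ord_eq_one
  exact ⟨u ^ n, zpow_ne_zero _ hu, by rw [P.ord_zpow hu, h, mul_one]⟩

theorem ord_neg (P : Place K) (f : K) : P.ord (-f) = P.ord f := by
  simp only [ord, Valuation.map_neg]

theorem ord_add_eq_of_lt (P : Place K) {f g : K} (hf : f ≠ 0) (hg : g ≠ 0)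
    (h : P.ord f < P.ord g) : f + g ≠ 0 ∧ P.ord (f + g) = P.ord f := by
  have h0 : f + g ≠ 0 := by
    intro h0
    rw [eq_neg_of_add_eq_zero_left h0, ord_neg] at h
    exact lt_irrefl _ h
  refine ⟨h0, le_antisymm ?_ ((le_min le_rfl h.le).trans (P.min_le_ord_add hf hg h0))⟩
  have h1 := P.min_le_ord_add h0 (neg_ne_zero.2 hg) (by simpa using hf)
  rw [ord_neg, add_neg_cancel_right] at h1
  rcases min_le_iff.1 h1 with h1 | h1
  · exact h1
  · omega

theorem ext_ring {P Q : Place K} (h : P.ring = Q.ring) : P = Q := by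
  cases P; cases Q; simp only at h; subst h; rfl

/-- Discrete valuation rings of `K` are pairwise incomparable. -/
theorem eq_of_ring_le {P Q : Place K} (h : P.ring ≤ Q.ring) : P = Q := by
  by_contra hne
  obtain ⟨g, hgQ, hgP⟩ : ∃ g ∈ Q.ring, g ∉ P.ring := by
    by_contra! hle
    exact hne (ext_ring (le_antisymm h hle))
  have hg0 : g ≠ 0 := by rintro rfl; exact hgP P.ring.zero_mem
  have hg : P.ord g < 0 := by
    rw [← not_le, P.ord_nonneg_iff hg0]; exact hgP
  have hQg := (Q.ord_nonneg_iff hg0).2 hgQ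
  obtain ⟨u, hu0, hu⟩ := Q.exists_ord_eq (-1)
  have key : ∀ w : K, w ≠ 0 → 0 ≤ P.ord w → 0 ≤ Q.ord w := fun w hw h' =>
    (Q.ord_nonneg_iff hw).2 (h ((P.ord_nonneg_iff hw).1 h'))
  -- If g is a unit at Q, powers of g⁻¹ raise the order of u at P without changing its order -1 at
  -- Q, so some u g⁻ᵐ lies in the ring of P but not in that of Q. If g vanishes at Q, then g⁻¹
  -- already does so.
  rcases hQg.eq_or_lt with hz | hp
  · have h1 := key (u⁻¹ * g ^ (P.ord u).natAbs)⁻¹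
      (inv_ne_zero (mul_ne_zero (inv_ne_zero hu0) (pow_ne_zero _ hg0)))
    have h2 : P.ord (u⁻¹ * g ^ (P.ord u).natAbs)⁻¹ =
        P.ord u - (P.ord u).natAbs * P.ord g := by
      rw [ord_inv, P.ord_mul (inv_ne_zero hu0) (pow_ne_zero _ hg0), ord_inv, P.ord_pow hg0]; ring
    have h3 : Q.ord (u⁻¹ * g ^ (P.ord u).natAbs)⁻¹ = -1 := by
      rw [ord_inv, Q.ord_mul (inv_ne_zero hu0) (pow_ne_zero _ hg0), ord_inv, Q.ord_pow hg0, ← hz,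
        hu]; ring
    rw [h2, h3] at h1
    have : 0 ≤ P.ord u - (P.ord u).natAbs * P.ord g := by
      have : ((P.ord u).natAbs : ℤ) * P.ord g ≤ -((P.ord u).natAbs : ℤ) := by nlinarith
      omega
    exact absurd (h1 this) (by norm_num)
  · have h1 := key g⁻¹ (inv_ne_zero hg0) (by rw [ord_inv]; omega)
    rw [ord_inv] at h1
    omega

/-- Incomparability gives a integral only at P and b integral only at Q; the quotient a / b works.
-/
theorem exists_ord_pos_neg {P Q : Place K} (h : P ≠ Q) :
    ∃ z : K, z ≠ 0 ∧ 0 < P.ord z ∧ Q.ord z < 0 := by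
  have h1 : ¬ P.ring ≤ Q.ring := fun h' => h (eq_of_ring_le h')
  have h2 : ¬ Q.ring ≤ P.ring := fun h' => h (eq_of_ring_le h').symm
  obtain ⟨a, haP, haQ⟩ := SetLike.not_le_iff_exists.1 h1
  obtain ⟨b, hbQ, hbP⟩ := SetLike.not_le_iff_exists.1 h2
  have ha : a ≠ 0 := by rintro rfl; exact haQ Q.ring.zero_mem
  have hb : b ≠ 0 := by rintro rfl; exact hbP P.ring.zero_mem
  rw [← ord_nonneg_iff _ ha] at haP haQ
  rw [← ord_nonneg_iff _ hb] at hbP hbQ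
  refine ⟨a * b⁻¹, mul_ne_zero ha (inv_ne_zero hb), ?_, ?_⟩ <;>
  · rw [ord_mul _ ha (inv_ne_zero hb), ord_inv]; omega

/-- Weak approximation: there is an element with a zero at `P` and poles at finitely many other
given places. -/
theorem exists_ord_pos_forall_neg (P : Place K) (S : Finset (Place K)) (hP : P ∉ S) :
    ∃ z : K, z ≠ 0 ∧ 0 < P.ord z ∧ ∀ Q ∈ S, Q.ord z < 0 := by
  classical
  induction S using Finset.induction_on with
  | empty =>
    obtain ⟨u, hu, h⟩ := P.exists_ord_eq_one
    exact ⟨u, hu, by omega, by simp⟩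
  | insert R S hR ih =>
    rw [Finset.mem_insert, not_or] at hP
    obtain ⟨z, hz0, hzP, hz⟩ := ih hP.2
    obtain ⟨y, hy0, hyP, hyR⟩ := exists_ord_pos_neg hP.1
    by_cases hzR : R.ord z < 0
    · refine ⟨z, hz0, hzP, fun Q hQ => ?_⟩
      rcases Finset.mem_insert.1 hQ with rfl | hQ
      exacts [hzR, hz Q hQ]
    -- for suitable `m` the poles of `y ^ m` at `R` and of `z` at `S` survive in `y ^ m + z`
    obtain ⟨m, hm1, hmR, hm⟩ : ∃ m : ℕ, 1 ≤ m ∧ m * R.ord y < R.ord z ∧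
        ∀ Q ∈ S, (m : ℤ) * Q.ord y ≠ Q.ord z := by
      -- This m exceeds every |ord_Q z| with Q ∈ S, so m ord_Q y is either 0 or too large in
      -- absolute value to equal the nonzero ord_Q z.
      refine ⟨1 + ∑ Q ∈ S, (Q.ord z).natAbs, by omega, ?_, fun Q hQ => ?_⟩
      · have : (1 : ℤ) ≤ ((1 + ∑ Q ∈ S, (Q.ord z).natAbs : ℕ) : ℤ) :=
          Nat.one_le_cast.2 (Nat.le_add_right _ _)
        nlinarith
      · intro h
        have h1 : (Q.ord z).natAbs ≤ ∑ Q ∈ S, (Q.ord z).natAbs :=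
          Finset.single_le_sum (f := fun Q => (Q.ord z).natAbs) (fun _ _ => Nat.zero_le _) hQ
        have h2 := congrArg Int.natAbs h
        rw [Int.natAbs_mul, Int.natAbs_natCast] at h2
        have h3 : (Q.ord z).natAbs ≠ 0 := by have := hz Q hQ; omega
        rcases Nat.eq_zero_or_pos (Q.ord y).natAbs with h0 | h0
        · rw [h0] at h2; omega
        · have := Nat.le_mul_of_pos_right (1 + ∑ Q ∈ S, (Q.ord z).natAbs) h0
          omega
    have hym := pow_ne_zero m hy0
    have hRs := R.ord_add_eq_of_lt hym hz0 (by rw [R.ord_pow hy0]; exact hmR)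
    refine ⟨y ^ m + z, hRs.1, ?_, fun Q hQ => ?_⟩
    · refine lt_of_lt_of_le (lt_min ?_ hzP) (P.min_le_ord_add hym hz0 hRs.1)
      rw [P.ord_pow hy0]; positivity
    · rcases Finset.mem_insert.1 hQ with rfl | hQ
      · rw [hRs.2, Q.ord_pow hy0]; nlinarith
      · rcases lt_or_gt_of_ne (hm Q hQ) with h | h
        · rw [← Q.ord_pow hy0] at h
          rw [(Q.ord_add_eq_of_lt hym hz0 h).2]
          exact h.trans (hz Q hQ)
        · rw [← Q.ord_pow hy0] at h
          rw [add_comm, (Q.ord_add_eq_of_lt hz0 hym h).2]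
          exact hz Q hQ

/-- There is an element that is congruent to `1` at `P` and vanishes at finitely many other given
places. -/
theorem exists_ord_sub_one_pos (P : Place K) (S : Finset (Place K)) (hP : P ∉ S) :
    ∃ e : K, e ≠ 0 ∧ P.ord e = 0 ∧ (e - 1 = 0 ∨ 0 < P.ord (e - 1)) ∧ ∀ Q ∈ S, 0 < Q.ord e := by
  obtain ⟨z, hz0, hzP, hz⟩ := P.exists_ord_pos_forall_neg S hP
  -- The witness is (1 + z)⁻¹: the zero of z at P makes it congruent to 1, and the poles of z on S
  -- become zeros.
  have h1 := P.ord_add_eq_of_lt one_ne_zero hz0 (by rwa [P.ord_one])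
  have he : (1 + z)⁻¹ - 1 = -(z * (1 + z)⁻¹) := by
    have := h1.1
    field_simp
    ring
  refine ⟨(1 + z)⁻¹, inv_ne_zero h1.1, by rw [ord_inv, h1.2, P.ord_one, neg_zero], Or.inr ?_,
    fun Q hQ => ?_⟩
  · rw [he, ord_neg, P.ord_mul hz0 (inv_ne_zero h1.1), ord_inv, h1.2, P.ord_one]; omega
  · have := Q.ord_add_eq_of_lt hz0 one_ne_zero (by rw [Q.ord_one]; exact hz Q hQ)
    rw [ord_inv, add_comm, this.2]
    have := hz Q hQ
    omega

end Place

/-! ### Function fields of one variable -/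

open IntermediateField Module

/-- `K` is a function field in one variable over `F` and `F` is algebraically closed in `K`. -/
class IsFunctionFieldOver (F K : Type*) [Field F] [Field K] [Algebra F K] : Prop where
  exists_transcendental : ∃ t : K, Transcendental F t
  finite_adjoin : ∀ x : K, Transcendental F x → FiniteDimensional F⟮x⟯ K
  mem_range_of_isAlgebraic : ∀ x : K, IsAlgebraic F x → x ∈ (algebraMap F K).range

/-- Transcendence degree is additive along F ⊆ F[X] ⊆ F(X) ⊆ K, and the last two steps are
algebraic. -/
theorem trdeg_functionField (F K : Type*) [Field F] [Field K] [Algebra F K] [Algebra (RatFunc F) K]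
    [IsScalarTower F (RatFunc F) K] [FiniteDimensional (RatFunc F) K] :
    Algebra.trdeg F K = 1 := by
  have h1 := lift_trdeg_add_eq F (RatFunc F) K
  rw [trdeg_eq_zero (R := RatFunc F), Cardinal.lift_zero, add_zero] at h1
  have h2 := lift_trdeg_add_eq F (Polynomial F) (RatFunc F)
  have : Algebra.IsAlgebraic (Polynomial F) (RatFunc F) :=
    IsLocalization.isAlgebraic _ (nonZeroDivisors (Polynomial F))
  rw [trdeg_eq_zero (R := Polynomial F), Polynomial.trdeg_of_isDomain] at h2
  simp only [Cardinal.lift_one, Cardinal.lift_zero, add_zero] at h2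
  rw [Cardinal.lift_id] at h2
  rw [← h2, Cardinal.lift_one] at h1
  exact Cardinal.lift_eq_one.1 h1.symm

theorem isFunctionFieldOver (F K : Type*) [Field F] [Field K] [Algebra F K] [Algebra (RatFunc F) K]
    [IsScalarTower F (RatFunc F) K] [FiniteDimensional (RatFunc F) K]
    (hconst : algebraicClosure F K = ⊥) : IsFunctionFieldOver F K where
  exists_transcendental := by
    refine ⟨algebraMap (RatFunc F) K RatFunc.X, ?_⟩
    rw [transcendental_algebraMap_iff (algebraMap (RatFunc F) K).injective]
    exact RatFunc.transcendental_X
  -- In transcendence degree one, x alone is a transcendence basis. So K is algebraic over F(x), and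
  -- finite because it is finitely generated as a field.
  finite_adjoin x hx := by
    have hx' : AlgebraicIndependent F (fun _ : Unit => x) :=
      algebraicIndependent_unique_type_iff.2 hx
    have hb : IsTranscendenceBasis F (fun _ : Unit => x) :=
      hx'.isTranscendenceBasis_of_lift_trdeg_le_of_finite (by simp [trdeg_functionField F K])
    have halg := hb.isAlgebraic_field
    rw [Set.range_const] at halg
    have : Algebra.EssFiniteType F (RatFunc F) :=
      have : Algebra.EssFiniteType (Polynomial F) (RatFunc F) :=
        .of_isLocalization _ (nonZeroDivisors (Polynomial F))
      .comp F (Polynomial F) _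
    have : Algebra.EssFiniteType F K := .comp F (RatFunc F) K
    have : Algebra.EssFiniteType F⟮x⟯ K := .of_comp F _ K
    exact Algebra.finite_of_essFiniteType_of_isAlgebraic
  mem_range_of_isAlgebraic x hx := by
    have h : x ∈ algebraicClosure F K := (mem_algebraicClosure_iff).2 hx
    rw [hconst] at h
    exact IntermediateField.mem_bot.1 h

/-! ### Linear independence over F(x) -/

section Independence
variable {F K : Type*} [Field F] [Field K] [Algebra F K]

open Polynomial in
/-- Elements of an `F[x]`-submodule `M` of `K` that are linearly independent modulo `x M` are
linearly independent over `F(x)`. -/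
theorem linearIndependent_adjoin_of_mod {x : K} (hx : Transcendental F x) (M : Submodule F K)
    (hM : ∀ m ∈ M, x * m ∈ M) {ι : Type*} [Fintype ι] (u : ι → K) (hu : ∀ i, u i ∈ M)
    (hind : ∀ c : ι → F, (∃ m ∈ M, ∑ i, c i • u i = x * m) → c = 0) :
    LinearIndependent F⟮x⟯ u := by
  have hx0 : x ≠ 0 := by rintro rfl; exact hx isAlgebraic_zero
  have hpM : ∀ (p : F[X]) (m), m ∈ M → aeval x p * m ∈ M := by
    intro p m hm
    induction p using Polynomial.induction_on' with
    | add p q hp hq => rw [map_add, add_mul]; exact M.add_mem hp hq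
    | monomial n a =>
      rw [aeval_monomial, mul_assoc, ← Algebra.smul_def]
      refine M.smul_mem _ ?_
      induction n with
      | zero => simpa using hm
      | succ n ih => rw [pow_succ', mul_assoc]; exact hM _ ih
  -- In a polynomial relation the constant terms give a relation modulo x M, hence vanish; then
  -- divide by x and repeat.
  have hcoeff : ∀ (k : ℕ) (p : ι → F[X]), ∑ i, aeval x (p i) * u i = 0 →
      ∀ i, (p i).coeff k = 0 := by
    have hsplit : ∀ p : ι → F[X], ∑ i, aeval x (p i) * u i =
        x * ∑ i, aeval x (divX (p i)) * u i + ∑ i, (p i).coeff 0 • u i := by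
      intro p
      rw [Finset.mul_sum, ← Finset.sum_add_distrib]
      refine Finset.sum_congr rfl fun i _ => ?_
      conv_lhs => rw [← X_mul_divX_add (p i)]
      rw [map_add, map_mul, aeval_X, aeval_C, Algebra.smul_def]
      ring
    have h0 : ∀ p : ι → F[X], ∑ i, aeval x (p i) * u i = 0 → (fun i => (p i).coeff 0) = 0 := by
      intro p hp
      refine hind _ ⟨-∑ i, aeval x (divX (p i)) * u i,
        M.neg_mem (M.sum_mem fun i _ => hpM _ _ (hu i)), ?_⟩
      rw [hsplit] at hp
      rw [mul_neg]
      exact eq_neg_of_add_eq_zero_right hp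
    intro k
    induction k with
    | zero => exact fun p hp i => congrFun (h0 p hp) i
    | succ k ih =>
      intro p hp i
      rw [← coeff_divX]
      refine ih (fun i => divX (p i)) ?_ i
      have h1 := h0 p hp
      rw [hsplit] at hp
      have h2 : ∑ i, (p i).coeff 0 • u i = 0 :=
        Finset.sum_eq_zero fun i _ => by rw [show (p i).coeff 0 = 0 from congrFun h1 i, zero_smul]
      rw [h2, add_zero] at hp
      exact (mul_eq_zero.1 hp).resolve_left hx0
  open scoped IntermediateField.algebraAdjoinAdjoin in
  -- Clearing denominators reduces independence over F(x) to independence over F[x].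
  rw [← LinearIndependent.iff_fractionRing (Algebra.adjoin F {x})]
  rw [Fintype.linearIndependent_iff]
  intro g hg i
  have hex : ∀ i, ∃ p : F[X], aeval x p = (g i : K) := fun i => by
    rw [← AlgHom.mem_range, ← Algebra.adjoin_singleton_eq_range_aeval]
    exact (g i).2
  choose p hp using hex
  have hz : ∑ i, aeval x (p i) * u i = 0 := by
    rw [← hg]
    exact Finset.sum_congr rfl fun i _ => by rw [hp]; rfl
  have : p i = 0 := Polynomial.ext fun k => by simpa using hcoeff k p hz i
  exact Subtype.ext (by rw [← hp, this, map_zero]; rfl)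

/-- The quotient of an `F[x]`-submodule `M` of `K` by `x M` has dimension at most `[K : F(x)]`. -/
theorem finrank_quotient_le {x : K} (hx : Transcendental F x) [FiniteDimensional F⟮x⟯ K]
    (M : Submodule F K) (hM : ∀ m ∈ M, x * m ∈ M) {Q : Type*} [AddCommGroup Q] [Module F Q]
    (π : M →ₗ[F] Q) (hπ : Function.Surjective π)
    (hker : ∀ m : M, π m = 0 ↔ ∃ m' ∈ M, (m : K) = x * m') :
    Module.Finite F Q ∧ finrank F Q ≤ finrank F⟮x⟯ K := by
  have h : ∀ s : Finset Q, LinearIndependent F (fun i : s => (i : Q)) →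
      s.card ≤ finrank F⟮x⟯ K := by
    intro s hs
    choose v hv using fun q : Q => hπ q
    have hli : LinearIndependent F⟮x⟯ (fun i : s => (v i : K)) := by
      refine linearIndependent_adjoin_of_mod hx M hM _ (fun i => (v i).2) fun c hc => ?_
      obtain ⟨m, hm, hcm⟩ := hc
      obtain ⟨w, hw⟩ : ∃ w : M, w = ∑ i : s, c i • v i := ⟨_, rfl⟩
      have hwK : (w : K) = x * m := by rw [← hcm, hw]; simp
      have hπw : π w = ∑ i : s, c i • (i : Q) := by rw [hw, map_sum]; simp [hv]
      have h0 : π w = 0 := (hker w).2 ⟨m, hm, hwK⟩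
      exact funext (Fintype.linearIndependent_iff.1 hs c (hπw ▸ h0))
    simpa using hli.fintype_card_le_finrank
  have hr := rank_le h
  have hfin : Module.Finite F Q :=
    Module.rank_lt_aleph0_iff.1 (hr.trans_lt (Cardinal.natCast_lt_aleph0))
  exact ⟨hfin, finrank_le_of_rank_le hr⟩

/-- Powers of x are independent over F inside F(x), so their products with an F(x)-basis are
independent over F. This supplies the lower bound for Riemann-Roch dimensions. -/
theorem linearIndependent_pow_smul_basis {x : K} (hx : Transcendental F x) {ι : Type*}
    (b : Basis ι F⟮x⟯ K) (m : ℕ) :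
    LinearIndependent F (fun p : Fin m × ι => x ^ (p.1 : ℕ) * b p.2) := by
  have h1 : Transcendental F (AdjoinSimple.gen F x) := by
    rwa [← transcendental_algebraMap_iff (A := K) (algebraMap F⟮x⟯ K).injective,
      AdjoinSimple.algebraMap_gen]
  have h2 : LinearIndependent F (fun n : ℕ => AdjoinSimple.gen F x ^ n) := by
    have := (Polynomial.basisMonomials F).linearIndependent.map'
      (Polynomial.aeval (AdjoinSimple.gen F x)).toLinearMap
      (LinearMap.ker_eq_bot.2 (transcendental_iff_injective.1 h1))
    have heq : (fun n : ℕ => AdjoinSimple.gen F x ^ n) =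
        (Polynomial.aeval (AdjoinSimple.gen F x)).toLinearMap ∘ Polynomial.basisMonomials F := by
      funext n
      simp [Polynomial.aeval_monomial]
    rwa [heq]
  exact linearIndependent_smul (h2.comp (fun i : Fin m => (i : ℕ)) Fin.val_injective)
    b.linearIndependent

theorem finrank_adjoin_inv (x : K) : finrank F⟮x⁻¹⟯ K = finrank F⟮x⟯ K := by
  have : F⟮x⁻¹⟯ = F⟮x⟯ := by
    apply le_antisymm <;> rw [adjoin_simple_le_iff]
    · exact inv_mem (mem_adjoin_simple_self F x)
    · simpa using inv_mem (mem_adjoin_simple_self F x⁻¹)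
  rw [this]

theorem transcendental_inv {x : K} (hx : Transcendental F x) : Transcendental F x⁻¹ :=
  fun h => hx (by simpa using h.inv)

end Independence

/-! ### Valuation rings are discrete, and functions without poles are constant -/

section Valuations
variable {F K : Type*} [Field F] [Finite F] [Field K] [Algebra F K]

theorem algebraMap_mem_valuationSubring (V : ValuationSubring K) (c : F) :
    algebraMap F K c ∈ V :=
  (V.valuation_le_one_iff _).1 (FiniteField.valuation_algebraMap_le_one _ c)

variable (F) in
/-- The constants in a valuation ring of `K`. -/
def valuationSubringConstants (V : ValuationSubring K) : F →+* V :=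
  (algebraMap F K).codRestrict V (algebraMap_mem_valuationSubring V)

variable (F) in
-- Algebraic elements are constants, and nonzero constants are units in every valuation ring.
theorem transcendental_of_not_isUnit [IsFunctionFieldOver F K] (V : ValuationSubring K) {x : V}
    (hx0 : x ≠ 0)
    (hx : ¬ IsUnit x) : Transcendental F (x : K) := by
  intro halg
  obtain ⟨c, hc⟩ := IsFunctionFieldOver.mem_range_of_isAlgebraic _ halg
  have hcx : valuationSubringConstants F V c = x := Subtype.ext hc
  apply hx
  rw [← hcx]
  refine IsUnit.map _ (isUnit_iff_ne_zero.2 ?_)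
  rintro rfl
  exact hx0 (by rw [← hcx, map_zero])

variable (F) in
-- For a non-unit x, the ring V is an F[x]-module, so V / xV has dimension at most [K : F(x)] over
-- the finite field F.
theorem finite_quotient_span_singleton [IsFunctionFieldOver F K] (V : ValuationSubring K) {x : V}
    (hx0 : x ≠ 0) :
    Finite (V ⧸ Ideal.span {x}) := by
  by_cases hx : IsUnit x
  · rw [Ideal.span_singleton_eq_top.2 hx]
    infer_instance
  have htr := transcendental_of_not_isUnit F V hx0 hx
  have := IsFunctionFieldOver.finite_adjoin _ htr
  let : Algebra F V := (valuationSubringConstants F V).toAlgebra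
  let M : Submodule F K :=
    { carrier := V
      zero_mem' := V.zero_mem
      add_mem' := V.add_mem _ _
      smul_mem' := fun c f hf => by
        rw [Algebra.smul_def]
        exact V.mul_mem _ _ (algebraMap_mem_valuationSubring V c) hf }
  let π : M →ₗ[F] V ⧸ Ideal.span {x} :=
    { toFun := fun m => Ideal.Quotient.mk _ (⟨m.1, m.2⟩ : V)
      map_add' := fun a b => map_add (Ideal.Quotient.mk (Ideal.span {x}))
        (⟨a.1, a.2⟩ : V) (⟨b.1, b.2⟩ : V)
      map_smul' := fun c a => by
        rw [RingHom.id_apply, Algebra.smul_def, IsScalarTower.algebraMap_apply F V,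
          Ideal.Quotient.algebraMap_eq, ← map_mul]
        congr 1
        exact Subtype.ext (Algebra.smul_def _ _) }
  have hfin := (finrank_quotient_le htr M (fun m hm => V.mul_mem _ _ x.2 hm) π
    (fun q => by
      obtain ⟨v, rfl⟩ := Ideal.Quotient.mk_surjective q
      exact ⟨⟨v.1, v.2⟩, rfl⟩)
    (fun m => by
      change Ideal.Quotient.mk _ (⟨m.1, m.2⟩ : V) = 0 ↔ _
      rw [Ideal.Quotient.eq_zero_iff_mem, Ideal.mem_span_singleton']
      constructor
      · rintro ⟨a, ha⟩
        exact ⟨a, a.2, by rw [mul_comm]; exact (congrArg Subtype.val ha).symm⟩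
      · rintro ⟨m', hm', h⟩
        exact ⟨⟨m', hm'⟩, Subtype.ext (by rw [h, mul_comm]; rfl)⟩)).1
  exact Module.finite_of_finite F

variable (F) in
/-- Every nontrivial valuation ring of a function field over a finite field is discrete. -/
theorem isDiscreteValuationRing_of_ne_top [IsFunctionFieldOver F K] (V : ValuationSubring K)
    (hV : V ≠ ⊤) :
    IsDiscreteValuationRing V := by
  have hnoeth : IsNoetherianRing V := by
    rw [isNoetherianRing_iff_ideal_fg]
    intro I
    by_cases hI : I = ⊥
    · rw [hI]; exact Submodule.fg_bot
    obtain ⟨x, hxI, hx0⟩ := Submodule.exists_mem_ne_zero_of_ne_bot hI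
    have := finite_quotient_span_singleton F V hx0
    -- The image of I modulo x is finite, and the kernel part is (x) itself.
    refine Submodule.fg_of_fg_map_of_fg_inf_ker (Ideal.span {x}).mkQ ?_ ?_
    · exact Submodule.FG.of_finite
    · rw [Submodule.ker_mkQ, inf_eq_right.2 ((Ideal.span_singleton_le_iff_mem I).2 hxI)]
      exact Submodule.fg_span_singleton x
  have hpid : IsPrincipalIdealRing V := (IsBezout.TFAE (R := V)).out 0 1 |>.1 hnoeth
  refine { not_a_field' := ?_ }
  intro hbot
  apply hV
  rw [eq_top_iff]
  intro f _
  have hfield := IsLocalRing.isField_iff_maximalIdeal_eq.2 hbot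
  rcases V.mem_or_inv_mem f with h | h
  · exact h
  by_cases hf : f = 0
  · rw [hf]; exact V.zero_mem
  obtain ⟨b, hb⟩ := hfield.mul_inv_cancel (a := (⟨f⁻¹, h⟩ : V))
    (fun h0 => inv_ne_zero hf (congrArg Subtype.val h0))
  have hb' : f⁻¹ * (b : K) = 1 := congrArg Subtype.val hb
  have : f = b := by field_simp at hb'; exact hb'.symm
  rw [this]; exact b.2

variable (F) in
/-- An element without poles is constant. -/
theorem mem_range_of_forall_ord_nonneg [IsFunctionFieldOver F K] {f : K}
    (hf : ∀ P : Place K, 0 ≤ P.ord f) :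
    f ∈ (algebraMap F K).range := by
  by_cases hf0 : f = 0
  · rw [hf0]; exact zero_mem _
  apply IsFunctionFieldOver.mem_range_of_isAlgebraic
  have hmem : f ∈ ⨅ V : {V : ValuationSubring K // (Set.range (algebraMap F K)) ⊆ V.toSubring},
      V.1.toSubring := by
    rw [Subring.mem_iInf]
    rintro ⟨V, hV⟩
    by_cases htop : V = ⊤
    · subst htop; trivial
    have hd := isDiscreteValuationRing_of_ne_top F V htop
    exact ((⟨V, hd⟩ : Place K).ord_nonneg_iff hf0).1 (hf ⟨V, hd⟩)
  -- The intersection of all valuation rings containing the constants is the integral closure of the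
  -- constants in K.
  rw [iInf_valuationSubring_superset] at hmem
  have hint : IsIntegral (Subring.closure (Set.range (algebraMap F K))) f := hmem
  obtain ⟨p, hp, hpf⟩ := hint
  let φ : F →+* Subring.closure (Set.range (algebraMap F K)) :=
    (algebraMap F K).codRestrict _ fun c => Subring.subset_closure ⟨c, rfl⟩
  have hφ : Function.Surjective φ := by
    rintro ⟨y, hy⟩
    have hle : Subring.closure (Set.range (algebraMap F K)) ≤ (algebraMap F K).range :=
      Subring.closure_le.2 (by rw [RingHom.coe_range])
    obtain ⟨c, rfl⟩ := hle hy
    exact ⟨c, rfl⟩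
  obtain ⟨p', rfl⟩ := Polynomial.map_surjective φ hφ p
  refine ⟨p', ?_, ?_⟩
  · rintro rfl
    exact hp.ne_zero (Polynomial.map_zero φ)
  · rw [Polynomial.eval₂_map] at hpf
    exact hpf

end Valuations

/-! ### Induction on effective divisors -/

section Divisors
variable {K : Type*} [Field K]

theorem Divisor.effective_induction {p : Divisor K → Prop} (zero : p 0)
    (add_toDivisor : ∀ (D : Divisor K) (P : Place K), 0 ≤ D → p D → p (D + P.toDivisor))
    {D : Divisor K} (hD : 0 ≤ D) : p D := by
  classical
  have hnat : ∀ (D : Divisor K) (P : Place K) (n : ℕ), 0 ≤ D → p D → p (D + n • P.toDivisor) := by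
    intro D P n hD hp
    induction n with
    | zero => simpa using hp
    | succ n ih =>
      rw [succ_nsmul, ← add_assoc]
      refine add_toDivisor _ _ (add_nonneg hD (nsmul_nonneg ?_ n)) ih
      exact Finsupp.single_nonneg.2 zero_le_one
  induction D using Finsupp.induction with
  | zero => exact zero
  | single_add P b D hP _ ih =>
    have hb : 0 ≤ b := by
      have := hD P
      rw [Finsupp.add_apply, Finsupp.single_eq_same, Finsupp.notMem_support_iff.1 hP] at this
      simpa using this
    have hD' : 0 ≤ D := by
      intro Q
      by_cases hQ : Q = P
      · rw [hQ, Finsupp.notMem_support_iff.1 hP]; rfl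
      · have := hD Q
        rwa [Finsupp.add_apply, Finsupp.single_eq_of_ne hQ, zero_add] at this
    obtain ⟨n, rfl⟩ := Int.eq_ofNat_of_zero_le hb
    have := hnat D P n hD' (ih hD')
    rwa [Finsupp.smul_single, nsmul_one, add_comm] at this

end Divisors

/-! ### Residue fields and local Riemann-Roch spaces -/

variable (F : Type*) {K : Type*} [Field F] [Finite F] [Field K] [Algebra F K]

instance Place.ringAlgebra (P : Place K) : Algebra F P.ring := (P.constants F).toAlgebra

instance (P : Place K) : IsScalarTower F P.ring K := .of_algebraMap_eq fun _ => rfl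

/-- The residue field is a quotient of the finite ring obtained by killing a uniformizer. Finiteness
excludes the default value 0 of `finrank`, so degrees are positive. -/
instance Place.finite_residueField [IsFunctionFieldOver F K] (P : Place K) :
    Module.Finite F (IsLocalRing.ResidueField P.ring) := by
  obtain ⟨u, hu0, hu⟩ := P.exists_ord_eq_one
  have hmem := (P.ord_nonneg_iff hu0).1 (by omega)
  have hmax := (P.ord_coe_pos_iff (f := ⟨u, hmem⟩) hu0).1 (by rw [hu]; exact one_pos)
  have := finite_quotient_span_singleton F P.ring (x := ⟨u, hmem⟩)
    (fun h => hu0 (congrArg Subtype.val h))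
  have : Finite (IsLocalRing.ResidueField P.ring) :=
    Finite.of_surjective (Ideal.Quotient.factor ((Ideal.span_singleton_le_iff_mem _).2 hmax))
      (Ideal.Quotient.factor_surjective _)
  exact Module.Finite.of_finite

theorem Place.degree_eq (P : Place K) :
    P.degree F = finrank F (IsLocalRing.ResidueField P.ring) := rfl

theorem Place.degree_pos [IsFunctionFieldOver F K] (P : Place K) : 0 < P.degree F :=
  finrank_pos (R := F) (M := IsLocalRing.ResidueField P.ring)

/-- The elements `f` with `ord f ≥ -D` at the places of `S`. -/
def localRRSpace (S : Set (Place K)) (D : Divisor K) : Submodule F K where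
  carrier := {f | f ≠ 0 → ∀ P ∈ S, -D P ≤ P.ord f}
  zero_mem' := fun h => (h rfl).elim
  add_mem' := by
    intro f g hf hg hfg P hP
    by_cases hf0 : f = 0
    · subst hf0
      rw [zero_add] at hfg ⊢
      exact hg hfg P hP
    by_cases hg0 : g = 0
    · subst hg0
      rw [add_zero] at hfg ⊢
      exact hf hfg P hP
    exact (le_min (hf hf0 P hP) (hg hg0 P hP)).trans (P.min_le_ord_add hf0 hg0 hfg)
  smul_mem' := by
    intro c f hf hcf P hP
    rw [Algebra.smul_def] at hcf ⊢
    have hc := left_ne_zero_of_mul hcf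
    have hf0 := right_ne_zero_of_mul hcf
    rw [P.ord_mul hc hf0, P.ord_algebraMap F c, zero_add]
    exact hf hf0 P hP

variable {F} in
theorem mem_localRRSpace {S : Set (Place K)} {D : Divisor K} {f : K} :
    f ∈ localRRSpace F S D ↔ (f ≠ 0 → ∀ P ∈ S, -D P ≤ P.ord f) := Iff.rfl

variable {F} in
theorem mem_riemannRochSpace {D : Divisor K} {f : K} :
    f ∈ riemannRochSpace F D ↔ (f ≠ 0 → ∀ P : Place K, -D P ≤ P.ord f) := Iff.rfl

theorem localRRSpace_univ (D : Divisor K) :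
    localRRSpace F Set.univ D = riemannRochSpace F D := by
  ext f; simp [mem_localRRSpace, mem_riemannRochSpace]

theorem localRRSpace_mono (S : Set (Place K)) {D E : Divisor K} (h : D ≤ E) :
    localRRSpace F S D ≤ localRRSpace F S E :=
  fun _ hf hf0 P hP => (neg_le_neg (h P)).trans (hf hf0 P hP)

theorem le_add_toDivisor (D : Divisor K) (P : Place K) : D ≤ D + P.toDivisor :=
  le_add_of_nonneg_right (Finsupp.single_nonneg.2 zero_le_one)

section Residue
variable {S : Set (Place K)} {P : Place K}

/-- The bound on poles at P is D P + 1, exactly the order of u. The residue of f u is therefore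
defined, and it vanishes when the pole of f has order at most D P. -/
theorem mul_mem_ring_of_mem_localRRSpace (hP : P ∈ S) (D : Divisor K) {u : K} (hu0 : u ≠ 0)
    (hu : P.ord u = D P + 1)
    {f : K} (hf : f ∈ localRRSpace F S (D + P.toDivisor)) : f * u ∈ P.ring := by
  by_cases hf0 : f = 0
  · rw [hf0, zero_mul]; exact P.ring.zero_mem
  rw [← P.ord_nonneg_iff (mul_ne_zero hf0 hu0), P.ord_mul hf0 hu0, hu]
  have := hf hf0 P hP
  rw [Finsupp.add_apply, Finsupp.single_eq_same] at this
  omega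

/-- The leading coefficient map at `P`. -/
def leadingCoeff (hP : P ∈ S) (D : Divisor K) {u : K} (hu0 : u ≠ 0) (hu : P.ord u = D P + 1) :
    localRRSpace F S (D + P.toDivisor) →ₗ[F] IsLocalRing.ResidueField P.ring where
  toFun f := IsLocalRing.residue P.ring
    ⟨f * u, mul_mem_ring_of_mem_localRRSpace F hP D hu0 hu f.2⟩
  map_add' f g := by
    rw [← map_add]
    congr 1
    exact Subtype.ext (add_mul _ _ _)
  map_smul' c f := by
    rw [RingHom.id_apply, Algebra.smul_def,
      IsScalarTower.algebraMap_apply F P.ring (IsLocalRing.ResidueField P.ring),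
      IsLocalRing.ResidueField.algebraMap_eq, ← map_mul]
    congr 1
    refine Subtype.ext ?_
    change (c • (f : K)) * u = algebraMap F K c * ((f : K) * u)
    rw [Algebra.smul_def, mul_assoc]

theorem leadingCoeff_eq_zero_iff (hP : P ∈ S) (D : Divisor K) {u : K} (hu0 : u ≠ 0)
    (hu : P.ord u = D P + 1)
    (f : localRRSpace F S (D + P.toDivisor)) :
    leadingCoeff F hP D hu0 hu f = 0 ↔ (f : K) ∈ localRRSpace F S D := by
  change IsLocalRing.residue P.ring _ = 0 ↔ _
  rw [IsLocalRing.residue_eq_zero_iff]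
  by_cases hf0 : (f : K) = 0
  · simp only [hf0, zero_mul]
    exact iff_of_true (zero_mem _) (zero_mem _)
  rw [← P.ord_coe_pos_iff (mul_ne_zero hf0 hu0), P.ord_mul hf0 hu0, hu, mem_localRRSpace]
  constructor
  · intro h _ Q hQ
    by_cases hQP : Q = P
    · rw [hQP]; omega
    · have := f.2 hf0 Q hQ
      rwa [Finsupp.add_apply, Finsupp.single_eq_of_ne hQP, add_zero] at this
  · intro h
    have := h hf0 P hP
    omega

/-- The element a / u has the right residue at P. Multiplying by a high power of an e that is
congruent to 1 at P and vanishes on the rest of S removes the unwanted poles there. -/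
theorem leadingCoeff_surjective (hP : P ∈ S) (D : Divisor K) (hS : S.Finite) {u : K}
    (hu0 : u ≠ 0) (hu : P.ord u = D P + 1) : Function.Surjective (leadingCoeff F hP D hu0 hu) := by
  classical
  intro r
  obtain ⟨a, rfl⟩ := IsLocalRing.residue_surjective r
  by_cases ha0 : a = 0
  · exact ⟨0, by rw [ha0, map_zero, map_zero]⟩
  have haK : (a : K) ≠ 0 := fun h => ha0 (Subtype.ext h)
  obtain ⟨e, he0, heP, he1, he⟩ :=
    P.exists_ord_sub_one_pos (hS.toFinset.erase P) (Finset.notMem_erase _ _)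
  have heR : e ∈ P.ring := (P.ord_nonneg_iff he0).1 heP.ge
  have hres : IsLocalRing.residue P.ring ⟨e, heR⟩ = 1 := by
    rw [← sub_eq_zero, ← map_one (IsLocalRing.residue P.ring), ← map_sub,
      IsLocalRing.residue_eq_zero_iff]
    by_cases h : e - 1 = 0
    · rw [show (⟨e, heR⟩ - 1 : P.ring) = 0 from Subtype.ext h]; exact zero_mem _
    · rw [← P.ord_coe_pos_iff (f := ⟨e, heR⟩ - 1) h]
      exact he1.resolve_left h
  have hau := mul_ne_zero haK (inv_ne_zero hu0)
  let N : ℕ := ∑ Q ∈ hS.toFinset, (D Q + Q.ord (a * u⁻¹)).natAbs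
  have hN : ∀ Q ∈ S, (D Q + Q.ord (a * u⁻¹)).natAbs ≤ N := fun Q hQ =>
    Finset.single_le_sum (f := fun Q => (D Q + Q.ord (a * u⁻¹)).natAbs)
      (fun _ _ => Nat.zero_le _) (hS.mem_toFinset.2 hQ)
  have hmem : a * u⁻¹ * e ^ N ∈ localRRSpace F S (D + P.toDivisor) := by
    intro _ Q hQ
    rw [Q.ord_mul hau (pow_ne_zero _ he0), Q.ord_pow he0]
    by_cases hQP : Q = P
    · subst hQP
      rw [heP, Q.ord_mul haK (inv_ne_zero hu0), Q.ord_inv, hu, Finsupp.add_apply,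
        Finsupp.single_eq_same]
      have := (Q.ord_nonneg_iff haK).2 a.2
      omega
    · rw [Finsupp.add_apply, Finsupp.single_eq_of_ne hQP]
      have h1 := he Q (Finset.mem_erase.2 ⟨hQP, hS.mem_toFinset.2 hQ⟩)
      have h2 := hN Q hQ
      have h3 : (N : ℤ) ≤ N * Q.ord e := le_mul_of_one_le_right (by positivity) h1
      omega
  refine ⟨⟨_, hmem⟩, ?_⟩
  · have h : leadingCoeff F hP D hu0 hu ⟨a * u⁻¹ * e ^ N, hmem⟩ =
        IsLocalRing.residue P.ring (a * ⟨e, heR⟩ ^ N) := by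
      refine congrArg (IsLocalRing.residue P.ring) (Subtype.ext ?_)
      change (a : K) * u⁻¹ * e ^ N * u = a * e ^ N
      field_simp
    rw [h, map_mul, map_pow, hres, one_pow, mul_one]

variable [IsFunctionFieldOver F K]

/-- The quotient is the residue field at P, by surjectivity of the leading coefficient. Indices of
subgroups multiply along chains, so they serve to add up the degrees of several places. -/
theorem relIndex_localRRSpace_add_toDivisor (hP : P ∈ S) (D : Divisor K) (hS : S.Finite) :
    (localRRSpace F S D).toAddSubgroup.relIndex (localRRSpace F S (D + P.toDivisor)).toAddSubgroup
      = Nat.card F ^ P.degree F := by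
  obtain ⟨u, hu0, hu⟩ := P.exists_ord_eq (D P + 1)
  have hker : (localRRSpace F S D).toAddSubgroup.addSubgroupOf
      (localRRSpace F S (D + P.toDivisor)).toAddSubgroup =
      (leadingCoeff F hP D hu0 hu).toAddMonoidHom.ker := by
    ext f
    exact (leadingCoeff_eq_zero_iff F hP D hu0 hu f).symm
  rw [AddSubgroup.relIndex, hker, AddSubgroup.index_ker,
    AddMonoidHom.range_eq_top.2 (leadingCoeff_surjective F hP D hS hu0 hu),
    Nat.card_congr AddSubgroup.topEquiv.toEquiv,
    Module.natCard_eq_pow_finrank (K := F) (V := IsLocalRing.ResidueField P.ring), P.degree_eq F]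

end Residue

/-! ### Degrees of divisors and the zeros of a function -/

section Degree
variable {F}

theorem divisorDegree_toDivisor (P : Place K) : divisorDegree F P.toDivisor = P.degree F := by
  simp [divisorDegree]

theorem divisorDegree_apply (D : Divisor K) :
    divisorDegree F D = ∑ P ∈ D.support, D P * (P.degree F : ℤ) := by
  simp [divisorDegree, Finsupp.sum]

theorem divisorDegree_nonneg {D : Divisor K} (hD : 0 ≤ D) : 0 ≤ divisorDegree F D := by
  rw [divisorDegree_apply]
  exact Finset.sum_nonneg fun P _ => mul_nonneg (hD P) (Int.natCast_nonneg _)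

theorem le_divisorDegree {D : Divisor K} (hD : 0 ≤ D) (P : Place K) :
    D P * P.degree F ≤ divisorDegree F D := by
  by_cases hP : P ∈ D.support
  · rw [divisorDegree_apply]
    exact Finset.single_le_sum (f := fun P => D P * (P.degree F : ℤ))
      (fun P _ => mul_nonneg (hD P) (Int.natCast_nonneg _)) hP
  · rw [Finsupp.notMem_support_iff.1 hP, zero_mul]
    exact divisorDegree_nonneg hD

variable [IsFunctionFieldOver F K]

theorem eq_zero_of_divisorDegree_eq_zero {D : Divisor K} (hD : 0 ≤ D)
    (h : divisorDegree F D = 0) : D = 0 := by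
  ext P
  have h1 := le_divisorDegree (F := F) hD P
  have h2 : (0 : ℤ) < P.degree F := by exact_mod_cast P.degree_pos F
  have h3 : 0 ≤ D P := hD P
  change D P = 0
  nlinarith

theorem relIndex_localRRSpace_add {S : Set (Place K)} (hS : S.Finite) (D : Divisor K)
    {E : Divisor K} (hE : 0 ≤ E) (hES : ∀ P ∉ S, E P = 0) :
    (localRRSpace F S D).toAddSubgroup.relIndex (localRRSpace F S (D + E)).toAddSubgroup
      = Nat.card F ^ (divisorDegree F E).toNat := by
  revert hES
  refine Divisor.effective_induction (p := fun E => (∀ P ∉ S, E P = 0) →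
    (localRRSpace F S D).toAddSubgroup.relIndex (localRRSpace F S (D + E)).toAddSubgroup
      = Nat.card F ^ (divisorDegree F E).toNat) ?_ ?_ hE
  · simp
  · intro E P hE ih hES
    have hE' : ∀ Q, 0 ≤ E Q := hE
    have hPS : P ∈ S := by
      by_contra hPS
      have := hES P hPS
      rw [Finsupp.add_apply, Finsupp.single_eq_same] at this
      have := hE' P
      omega
    have hES' : ∀ Q ∉ S, E Q = 0 := by
      intro Q hQ
      have := hES Q hQ
      rwa [Finsupp.add_apply, Finsupp.single_eq_of_ne (by rintro rfl; exact hQ hPS),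
        add_zero] at this
    rw [← AddSubgroup.relIndex_mul_relIndex _ (localRRSpace F S (D + E)).toAddSubgroup, ih hES',
      ← add_assoc, relIndex_localRRSpace_add_toDivisor F hPS _ hS, map_add,
      divisorDegree_toDivisor, Int.toNat_add (divisorDegree_nonneg hE) (Int.natCast_nonneg _),
      Int.toNat_natCast, pow_add]
    · exact Submodule.toAddSubgroup_mono (localRRSpace_mono F S (le_add_of_nonneg_right hE))
    · rw [← add_assoc]
      exact Submodule.toAddSubgroup_mono (localRRSpace_mono F S (le_add_toDivisor _ P))

/-- The zeros of a transcendental element `x` have total degree at most `[K : F(x)]`. -/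
theorem divisorDegree_le_finrank_adjoin {x : K} (hx : Transcendental F x) {E : Divisor K}
    (hE : 0 ≤ E) (hEx : ∀ P ∈ E.support, E P = P.ord x) :
    divisorDegree F E ≤ finrank F⟮x⟯ K := by
  have hx0 : x ≠ 0 := by rintro rfl; exact hx isAlgebraic_zero
  have := IsFunctionFieldOver.finite_adjoin x hx
  have hsupp : ∀ P ∉ (E.support : Set (Place K)), E P = 0 := fun P hP =>
    Finsupp.notMem_support_iff.1 hP
  have hidx := relIndex_localRRSpace_add (F := F) E.support.finite_toSet (-E) hE hsupp
  rw [neg_add_cancel] at hidx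
  -- With M the functions integral on the support of E, this says that x M is the local space of -E.
  -- The index of x M in M is then |F| ^ deg E, while `finrank_quotient_le` bounds the dimension of
  -- M / x M.
  have hM : ∀ m : K, (∃ m' ∈ localRRSpace F (E.support : Set (Place K)) 0, m = x * m') ↔
      m ∈ localRRSpace F (E.support : Set (Place K)) (-E) := by
    intro m
    constructor
    · rintro ⟨m', hm', rfl⟩ hne P hP
      have hm0 := right_ne_zero_of_mul hne
      have := hm' hm0 P hP
      rw [P.ord_mul hx0 hm0, Finsupp.neg_apply, hEx P hP]
      simpa using this
    · intro hm
      refine ⟨x⁻¹ * m, fun hne P hP => ?_, by field_simp⟩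
      have hm0 := right_ne_zero_of_mul hne
      have := hm hm0 P hP
      rw [Finsupp.neg_apply, hEx P hP] at this
      rw [P.ord_mul (inv_ne_zero hx0) hm0, P.ord_inv, Finsupp.zero_apply]
      omega
  have hle : localRRSpace F (E.support : Set (Place K)) (-E) ≤
      localRRSpace F (E.support : Set (Place K)) 0 :=
    localRRSpace_mono F _ (neg_nonpos.2 hE)
  obtain ⟨hfin, hrank⟩ := finrank_quotient_le hx
    (localRRSpace F (E.support : Set (Place K)) 0)
    (fun m hm => hle ((hM _).1 ⟨m, hm, rfl⟩))
    ((localRRSpace F (E.support : Set (Place K)) (-E)).submoduleOf _).mkQ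
    (Submodule.mkQ_surjective _)
    (fun m => by
      rw [← LinearMap.mem_ker, Submodule.ker_mkQ, hM]
      rfl)
  have hcard : Nat.card F ^ finrank F (_ ⧸
      (localRRSpace F (E.support : Set (Place K)) (-E)).submoduleOf
        (localRRSpace F (E.support : Set (Place K)) 0)) =
      Nat.card F ^ (divisorDegree F E).toNat := by
    rw [← hidx, ← Module.natCard_eq_pow_finrank (K := F)]
    rfl
  have h1 := Nat.pow_right_injective Finite.one_lt_card hcard
  rw [h1] at hrank
  exact Int.toNat_le.1 hrank

/-- Enlarging a divisor by a place `P` enlarges the space of elements with prescribed poles by at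
most `deg P` dimensions. -/
theorem finrank_localRRSpace_add_toDivisor_le {S : Set (Place K)} {P : Place K} (hP : P ∈ S)
    (D : Divisor K) [Module.Finite F (localRRSpace F S D)] :
    Module.Finite F (localRRSpace F S (D + P.toDivisor)) ∧
    finrank F (localRRSpace F S (D + P.toDivisor)) ≤
      finrank F (localRRSpace F S D) + P.degree F := by
  obtain ⟨u, hu0, hu⟩ := P.exists_ord_eq (D P + 1)
  let φ := leadingCoeff F hP D hu0 hu
  have hker : LinearMap.ker φ = (localRRSpace F S D).submoduleOf _ := by
    ext f
    exact leadingCoeff_eq_zero_iff F hP D hu0 hu f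
  let e : LinearMap.ker φ ≃ₗ[F] localRRSpace F S D :=
    (LinearEquiv.ofEq _ _ hker).trans
      (Submodule.comapSubtypeEquivOfLe (localRRSpace_mono F _ (le_add_toDivisor D P)))
  have : Module.Finite F (LinearMap.ker φ) := Module.Finite.equiv e.symm
  have : Module.Finite F (_ ⧸ LinearMap.ker φ) := Module.Finite.equiv φ.quotKerEquivRange.symm
  have hfin : Module.Finite F (localRRSpace F S (D + P.toDivisor)) :=
    Module.Finite.of_submodule_quotient (LinearMap.ker φ)
  refine ⟨hfin, ?_⟩
  rw [← φ.finrank_range_add_finrank_ker, e.finrank_eq, P.degree_eq F, add_comm]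
  exact Nat.add_le_add_left (Submodule.finrank_le _) _

end Degree

/-! ### Principal divisors and Riemann's inequality -/

section PrincipalDivisors
variable (F : Type*) {K : Type*} [Field F] [Finite F] [Field K] [Algebra F K]

theorem transcendental_or_forall_ord_eq_zero [IsFunctionFieldOver F K] (x : K) :
    Transcendental F x ∨ ∀ P : Place K, P.ord x = 0 := by
  by_cases hx : Transcendental F x
  · exact Or.inl hx
  · obtain ⟨c, rfl⟩ := IsFunctionFieldOver.mem_range_of_isAlgebraic (F := F) x (not_not.1 hx)
    exact Or.inr fun P => P.ord_algebraMap F c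

/-- More than [K : F(x)] zeros would support a divisor violating `divisorDegree_le_finrank_adjoin`.
-/
theorem finite_setOf_ord_pos [IsFunctionFieldOver F K] (x : K) :
    {P : Place K | 0 < P.ord x}.Finite := by
  classical
  rcases transcendental_or_forall_ord_eq_zero F x with hx | hx
  · by_contra hinf
    obtain ⟨T, hT, hcard⟩ := Set.Infinite.exists_subset_card_eq hinf (finrank F⟮x⟯ K + 1)
    have hT' : ∀ P ∈ T, 0 < P.ord x := fun P hP => hT hP
    let E : Divisor K := Finsupp.onFinset T (fun P => if P ∈ T then P.ord x else 0)
      (fun P hP => by by_contra h; exact hP (if_neg h))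
    have hET : ∀ P ∈ T, E P = P.ord x := fun P hP => if_pos hP
    have hE0 : ∀ P ∉ T, E P = 0 := fun P hP => if_neg hP
    have hsupp : E.support = T := by
      ext P
      rw [Finsupp.mem_support_iff]
      by_cases hP : P ∈ T
      · have := hT' P hP
        simp only [hET P hP, hP, iff_true]; omega
      · simp [hE0 P hP, hP]
    have hE : 0 ≤ E := by
      intro P
      by_cases hP : P ∈ T
      · rw [hET P hP]; exact (hT' P hP).le
      · rw [hE0 P hP]; rfl
    have h1 := divisorDegree_le_finrank_adjoin hx hE (by rw [hsupp]; exact hET)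
    have h2 : (T.card : ℤ) ≤ divisorDegree F E := by
      rw [divisorDegree_apply, hsupp, Finset.card_eq_sum_ones, Nat.cast_sum]
      refine Finset.sum_le_sum fun P hP => ?_
      rw [hET P hP, Nat.cast_one]
      have h3 := hT' P hP
      have h4 : (0 : ℤ) < P.degree F := by exact_mod_cast P.degree_pos F
      exact Int.add_one_le_iff.2 (mul_pos h3 h4)
    omega
  · simp [hx]

theorem exists_zeroDivisor [IsFunctionFieldOver F K] (x : K) :
    ∃ Z : Divisor K, ∀ P : Place K, Z P = max (P.ord x) 0 := by
  classical
  refine ⟨Finsupp.onFinset (finite_setOf_ord_pos F x).toFinset (fun P => max (P.ord x) 0)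
    fun P hP => ?_, fun P => rfl⟩
  rw [Set.Finite.mem_toFinset, Set.mem_ofPred_eq]
  by_contra h
  exact hP (max_eq_right (not_lt.1 h))

theorem exists_hasDivisor [IsFunctionFieldOver F K] {x : K} (hx : x ≠ 0) :
    ∃ D : Divisor K, HasDivisor x D := by
  obtain ⟨Z, hZ⟩ := exists_zeroDivisor F x
  obtain ⟨N, hN⟩ := exists_zeroDivisor F x⁻¹
  refine ⟨Z - N, hx, fun P => ?_⟩
  rw [Finsupp.sub_apply, hZ, hN, P.ord_inv]
  omega

variable (D : Divisor K)

/-- The dimension of the Riemann-Roch space of `D`. -/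
def riemannRochDim : ℕ := finrank F (riemannRochSpace F D)

variable {F}

theorem riemannRochSpace_mono {D E : Divisor K} (h : D ≤ E) :
    riemannRochSpace F D ≤ riemannRochSpace F E := by
  rw [← localRRSpace_univ, ← localRRSpace_univ]
  exact localRRSpace_mono F _ h

theorem riemannRochSpace_zero [IsFunctionFieldOver F K] :
    riemannRochSpace F (0 : Divisor K) = Submodule.span F {1} := by
  ext f
  rw [Submodule.mem_span_singleton, mem_riemannRochSpace]
  constructor
  · intro hf
    obtain ⟨c, rfl⟩ := mem_range_of_forall_ord_nonneg F (f := f) fun P => by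
      by_cases hf0 : f = 0
      · rw [hf0]; simp [Place.ord]
      · simpa using hf hf0 P
    exact ⟨c, (Algebra.algebraMap_eq_smul_one c).symm⟩
  · rintro ⟨c, rfl⟩ _ P
    rw [← Algebra.algebraMap_eq_smul_one, P.ord_algebraMap F c]
    rfl

/-- One place is added at a time. Finiteness is carried along because the step for each place needs
it. -/
theorem finite_and_riemannRochDim_add_le [IsFunctionFieldOver F K] (D : Divisor K)
    [Module.Finite F (riemannRochSpace F D)] {E : Divisor K} (hE : 0 ≤ E) :
    Module.Finite F (riemannRochSpace F (D + E)) ∧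
      (riemannRochDim F (D + E) : ℤ) ≤ riemannRochDim F D + divisorDegree F E := by
  refine Divisor.effective_induction (p := fun E => Module.Finite F (riemannRochSpace F (D + E)) ∧
      (riemannRochDim F (D + E) : ℤ) ≤ riemannRochDim F D + divisorDegree F E) ?_ ?_ hE
  · rw [add_zero, map_zero, add_zero]
    exact ⟨inferInstance, le_rfl⟩
  · rintro E P hE ⟨h1, h2⟩
    rw [← localRRSpace_univ] at h1
    have h3 := finrank_localRRSpace_add_toDivisor_le (F := F) (Set.mem_univ P) (D + E)
    rw [localRRSpace_univ, localRRSpace_univ, add_assoc] at h3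
    refine ⟨h3.1, ?_⟩
    rw [map_add, divisorDegree_toDivisor]
    have h4 : riemannRochDim F (D + (E + P.toDivisor)) ≤ riemannRochDim F (D + E) + P.degree F :=
      h3.2
    omega

instance finite_riemannRochSpace [IsFunctionFieldOver F K] :
    Module.Finite F (riemannRochSpace F D) := by
  have h0 : Module.Finite F (riemannRochSpace F (0 : Divisor K)) := by
    rw [riemannRochSpace_zero]; infer_instance
  have h1 := (finite_and_riemannRochDim_add_le (F := F) 0 (E := D ⊔ 0) le_sup_right).1
  have hle : riemannRochSpace F D ≤ riemannRochSpace F (0 + (D ⊔ 0)) := by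
    rw [zero_add]; exact riemannRochSpace_mono le_sup_left
  exact Module.Finite.of_injective (Submodule.inclusion hle) (Submodule.inclusion_injective hle)

theorem riemannRochDim_add_le [IsFunctionFieldOver F K] {E : Divisor K} (hE : 0 ≤ E) :
    (riemannRochDim F (D + E) : ℤ) ≤ riemannRochDim F D + divisorDegree F E :=
  (finite_and_riemannRochDim_add_le D hE).2

/-- Lower bound for the dimensions of the Riemann-Roch spaces of the multiples of a pole divisor. -/
theorem exists_le_riemannRochDim_nsmul [IsFunctionFieldOver F K] {x : K} (hx : Transcendental F x)
    {B : Divisor K} (hB : ∀ P : Place K, B P = max (P.ord x⁻¹) 0) :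
    ∃ c : ℤ, ∀ l : ℕ, (finrank F⟮x⟯ K * (l + 1) : ℤ) ≤ riemannRochDim F (l • B) + c := by
  have := IsFunctionFieldOver.finite_adjoin x hx
  have hx0 : x ≠ 0 := by rintro rfl; exact hx isAlgebraic_zero
  let b := finBasis F⟮x⟯ K
  choose Z hZ using fun j => exists_zeroDivisor F (b j)⁻¹
  have hZ0 : ∀ j, 0 ≤ Z j := fun j P => by rw [hZ]; exact le_max_right _ _
  -- C dominates the poles of all basis elements, so xⁱ bⱼ ∈ L(lB + C) for i ≤ l; passing back to
  -- L(lB) costs at most deg C.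
  let C : Divisor K := ∑ j, Z j
  have hC : 0 ≤ C := Finset.sum_nonneg fun j _ => hZ0 j
  refine ⟨divisorDegree F C, fun l => le_trans ?_ (riemannRochDim_add_le (l • B) hC)⟩
  have hmem : ∀ p : Fin (l + 1) × Fin (finrank F⟮x⟯ K),
      x ^ (p.1 : ℕ) * b p.2 ∈ riemannRochSpace F (l • B + C) := by
    rintro ⟨i, j⟩ _ P
    have hCj : Z j P ≤ C P :=
      (Finset.single_le_sum (f := Z) (fun j _ => hZ0 j) (Finset.mem_univ j)) P
    rw [hZ, P.ord_inv] at hCj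
    have hBP := hB P
    rw [P.ord_inv] at hBP
    have hi : (i : ℤ) ≤ l := by exact_mod_cast Nat.lt_succ_iff.1 i.2
    have h1 : -(l * B P) ≤ i * P.ord x := by
      have h2 : 0 ≤ B P := by rw [hBP]; exact le_max_right _ _
      have h3 : -P.ord x ≤ B P := by rw [hBP]; exact le_max_left _ _
      have h4 : (0 : ℤ) ≤ i := Int.natCast_nonneg _
      nlinarith
    have h5 := (le_max_left _ _).trans hCj
    rw [P.ord_mul (pow_ne_zero _ hx0) (b.ne_zero j), P.ord_pow hx0, Finsupp.add_apply,
      Finsupp.smul_apply, nsmul_eq_mul]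
    simp only
    linarith
  have hli : LinearIndependent F (fun p => (⟨_, hmem p⟩ : riemannRochSpace F (l • B + C))) :=
    LinearIndependent.of_comp (riemannRochSpace F (l • B + C)).subtype
      (linearIndependent_pow_smul_basis hx b (l + 1))
  have := hli.fintype_card_le_finrank
  rw [Fintype.card_prod, Fintype.card_fin, Fintype.card_fin, mul_comm] at this
  exact_mod_cast this

/-- The pole divisor of a transcendental `x` has degree `[K : F(x)]`. -/
theorem divisorDegree_poleDivisor [IsFunctionFieldOver F K] {x : K} (hx : Transcendental F x)
    {B : Divisor K} (hB : ∀ P : Place K, B P = max (P.ord x⁻¹) 0) :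
    divisorDegree F B = finrank F⟮x⟯ K := by
  have hB0 : 0 ≤ B := fun P => by rw [hB]; exact le_max_right _ _
  apply le_antisymm
  · rw [← finrank_adjoin_inv]
    refine divisorDegree_le_finrank_adjoin (transcendental_inv hx) hB0 fun P hP => ?_
    have := hB P
    rw [Finsupp.mem_support_iff] at hP
    omega
  · obtain ⟨c, hc⟩ := exists_le_riemannRochDim_nsmul hx hB
    by_contra! hlt
    -- With n = [K : F(x)] and deg B ≤ n - 1, the two bounds give n(l + 1) ≤ dim L(0) + l(n - 1) +
    -- c, that is, l + n ≤ dim L(0) + c. This l refutes it.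
    obtain ⟨l, hl⟩ : ∃ l : ℕ, l = (riemannRochDim F (0 : Divisor K) + c).toNat := ⟨_, rfl⟩
    have h1 := hc l
    have h2 := riemannRochDim_add_le (F := F) 0 (nsmul_nonneg hB0 l)
    rw [zero_add, map_nsmul, nsmul_eq_mul] at h2
    have h3 : (l : ℤ) * divisorDegree F B ≤ l * (finrank F⟮x⟯ K - 1) :=
      mul_le_mul_of_nonneg_left (by omega) (Int.natCast_nonneg _)
    have h4 := divisorDegree_nonneg (F := F) hB0
    have h5 := Int.self_le_toNat (riemannRochDim F (0 : Divisor K) + c)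
    rw [← hl] at h5
    linarith

/-- Principal divisors have degree zero. -/
theorem HasDivisor.divisorDegree_eq_zero [IsFunctionFieldOver F K] {x : K} {D : Divisor K}
    (h : HasDivisor x D) : divisorDegree F D = 0 := by
  rcases transcendental_or_forall_ord_eq_zero F x with hx | hx
  · obtain ⟨Z, hZ⟩ := exists_zeroDivisor F x
    obtain ⟨N, hN⟩ := exists_zeroDivisor F x⁻¹
    have hD : D = Z - N := by
      ext P
      rw [Finsupp.sub_apply, hZ, hN, ← h.2 P, P.ord_inv]
      omega
    rw [hD, map_sub, divisorDegree_poleDivisor hx hN,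
      divisorDegree_poleDivisor (transcendental_inv hx) (by simpa using hZ), finrank_adjoin_inv,
      sub_self]
  · have : D = 0 := by
      ext P
      rw [← h.2 P, hx]; rfl
    rw [this, map_zero]

/-- The Riemann-Roch dimension is invariant under linear equivalence. -/
theorem HasDivisor.riemannRochDim_add {z : K} {E : Divisor K} (h : HasDivisor z E)
    (D : Divisor K) : riemannRochDim F (D + E) = riemannRochDim F D := by
  have hle : ∀ {z : K} {E : Divisor K} (h : HasDivisor z E) (D : Divisor K) (f : K),
      f ∈ riemannRochSpace F (D + E) → z * f ∈ riemannRochSpace F D := by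
    intro z E h D f hf hne P
    have hf0 := right_ne_zero_of_mul hne
    have := hf hf0 P
    rw [P.ord_mul h.1 hf0, h.2 P]
    rw [Finsupp.add_apply] at this
    omega
  have hinv : HasDivisor z⁻¹ (-E) :=
    ⟨inv_ne_zero h.1, fun P => by rw [P.ord_inv, h.2 P, Finsupp.neg_apply]⟩
  have hmul : Function.Injective (LinearMap.mulLeft F z) := mul_right_injective₀ h.1
  have hmap : (riemannRochSpace F (D + E)).map (LinearMap.mulLeft F z) = riemannRochSpace F D := by
    ext f
    constructor
    · rintro ⟨g, hg, rfl⟩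
      exact hle h D g hg
    · intro hf
      refine ⟨z⁻¹ * f, hle hinv _ f (by simpa using hf), ?_⟩
      exact mul_inv_cancel_left₀ h.1 f
  rw [riemannRochDim, riemannRochDim, ← hmap]
  exact ((Submodule.equivMapOfInjective _ hmul _).finrank_eq)

/-- Riemann's inequality. -/
theorem exists_divisorDegree_le_riemannRochDim_add (F K : Type*) [Field F] [Finite F] [Field K]
    [Algebra F K] [IsFunctionFieldOver F K] :
    ∃ γ : ℤ, ∀ D : Divisor K, divisorDegree F D ≤ riemannRochDim F D + γ := by
  obtain ⟨x, hx⟩ := IsFunctionFieldOver.exists_transcendental (F := F) (K := K)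
  have := IsFunctionFieldOver.finite_adjoin x hx
  have hn : 0 < finrank F⟮x⟯ K := finrank_pos
  obtain ⟨B, hB⟩ := exists_zeroDivisor F x⁻¹
  have hB0 : 0 ≤ B := fun P => by rw [hB]; exact le_max_right _ _
  obtain ⟨c, hc⟩ := exists_le_riemannRochDim_nsmul hx hB
  have hdeg := divisorDegree_poleDivisor hx hB
  -- The difference deg - dim is monotone and invariant under linear equivalence, so it suffices to
  -- move D below a multiple of B.
  have hmono : ∀ {D E : Divisor K}, D ≤ E → divisorDegree F D - riemannRochDim F D ≤
      divisorDegree F E - riemannRochDim F E := by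
    intro D E hDE
    have h := riemannRochDim_add_le (F := F) D (sub_nonneg.2 hDE)
    rw [add_sub_cancel, map_sub] at h
    linarith
  refine ⟨c, fun D => ?_⟩
  -- For this l the space L(lB - D⁺), with D⁺ = D ⊔ 0, contains some z ≠ 0, and D⁺ - div z ≤ lB.
  obtain ⟨l, hl⟩ : ∃ l : ℕ, l = (divisorDegree F (D ⊔ 0) + c).toNat := ⟨_, rfl⟩
  have hl' := Int.self_le_toNat (divisorDegree F (D ⊔ 0) + c)
  rw [← hl] at hl'
  have h1 := hc l
  have h2 := riemannRochDim_add_le (F := F) (l • B - (D ⊔ 0)) (E := D ⊔ 0) le_sup_right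
  rw [sub_add_cancel] at h2
  have hpos : 0 < riemannRochDim F (l • B - (D ⊔ 0)) := by
    have : (1 : ℤ) ≤ finrank F⟮x⟯ K := by exact_mod_cast hn
    have : (l : ℤ) + 1 ≤ finrank F⟮x⟯ K * (l + 1) := by nlinarith
    omega
  have hne : riemannRochSpace F (l • B - (D ⊔ 0)) ≠ ⊥ := by
    intro h
    rw [riemannRochDim, h, finrank_bot] at hpos
    exact lt_irrefl _ hpos
  obtain ⟨z, hz, hz0⟩ := Submodule.exists_mem_ne_zero_of_ne_bot hne
  obtain ⟨E, hE⟩ := exists_hasDivisor F hz0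
  have hle : (D ⊔ 0) + (-E) ≤ l • B := by
    intro P
    have := hz hz0 P
    rw [hE.2 P, Finsupp.sub_apply] at this
    rw [Finsupp.add_apply, Finsupp.neg_apply]
    omega
  have hinv : HasDivisor z⁻¹ (-E) :=
    ⟨inv_ne_zero hz0, fun P => by rw [P.ord_inv, hE.2 P, Finsupp.neg_apply]⟩
  have h3 := hmono hle
  rw [hinv.riemannRochDim_add, map_add, hinv.divisorDegree_eq_zero, map_nsmul, hdeg,
    nsmul_eq_mul] at h3
  have h4 := hmono (le_sup_left : D ≤ D ⊔ 0)
  have h5 : (l : ℤ) * finrank F⟮x⟯ K ≤ finrank F⟮x⟯ K * (l + 1) := by nlinarith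
  linarith

end PrincipalDivisors

/-! ### Finiteness of Pic⁰ -/

section Finiteness
variable (F K : Type*) [Field F] [Finite F] [Field K] [Algebra F K] [IsFunctionFieldOver F K]

/-- The residue field at such a place has q ^ d elements, where q = |F|. So either t has a pole
there or t ^ (q ^ d) - t has a zero; the latter element is nonzero since t is transcendental. -/
theorem finite_setOf_degree_eq (d : ℕ) : {P : Place K | P.degree F = d}.Finite := by
  obtain ⟨t, ht⟩ := IsFunctionFieldOver.exists_transcendental (F := F) (K := K)
  have ht0 : t ≠ 0 := by rintro rfl; exact ht isAlgebraic_zero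
  refine ((finite_setOf_ord_pos F t⁻¹).union
    (finite_setOf_ord_pos F (t ^ Nat.card F ^ d - t))).subset fun P hP => ?_
  by_cases htP : t ∈ P.ring
  · right
    have hd : d ≠ 0 := hP ▸ (P.degree_pos F).ne'
    have hne : t ^ Nat.card F ^ d - t ≠ 0 := by
      intro h
      refine ht ⟨Polynomial.X ^ Nat.card F ^ d - Polynomial.X,
        FiniteField.X_pow_card_pow_sub_X_ne_zero F hd Finite.one_lt_card, ?_⟩
      simpa using h
    have : Finite (IsLocalRing.ResidueField P.ring) := Module.finite_of_finite F
    have := Fintype.ofFinite (IsLocalRing.ResidueField P.ring)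
    have hcard : Nat.card F ^ d = Fintype.card (IsLocalRing.ResidueField P.ring) := by
      rw [← Nat.card_eq_fintype_card,
        Module.natCard_eq_pow_finrank (K := F) (V := IsLocalRing.ResidueField P.ring),
        ← P.degree_eq F, show P.degree F = d from hP]
    rw [hcard] at hne
    rw [Set.mem_ofPred_eq, hcard]
    obtain ⟨a, rfl⟩ : ∃ a : P.ring, (a : K) = t := ⟨⟨t, htP⟩, rfl⟩
    have hres : IsLocalRing.residue P.ring
        (a ^ Fintype.card (IsLocalRing.ResidueField P.ring) - a) = 0 := by
      rw [map_sub, map_pow, FiniteField.pow_card, sub_self]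
    generalize Fintype.card (IsLocalRing.ResidueField P.ring) = m at hne hres ⊢
    rw [IsLocalRing.residue_eq_zero_iff] at hres
    exact (P.ord_coe_pos_iff (f := a ^ m - a) hne).2 hres
  · left
    change 0 < P.ord t⁻¹
    rw [P.ord_pos_iff (inv_ne_zero ht0), inv_inv]
    exact htP

/-- Such a divisor involves only places of degree at most n, with coefficients at most n, so it lies
in a finite interval. -/
theorem finite_setOf_effective_divisorDegree_eq (n : ℤ) :
    {D : Divisor K | 0 ≤ D ∧ divisorDegree F D = n}.Finite := by
  classical
  have hT : {P : Place K | (P.degree F : ℤ) ≤ n}.Finite := by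
    refine ((Set.finite_Iic n.toNat).biUnion fun d _ => finite_setOf_degree_eq F K d).subset
      fun P hP => ?_
    have hP' : (P.degree F : ℤ) ≤ n := hP
    exact Set.mem_biUnion (x := P.degree F) (by rw [Set.mem_Iic]; omega) rfl
  let M : Divisor K := Finsupp.onFinset hT.toFinset
    (fun P => if P ∈ hT.toFinset then n else 0) (fun P hP => by by_contra h; exact hP (if_neg h))
  refine (Set.finite_Icc 0 M).subset ?_
  rintro D ⟨hD, hdeg⟩
  refine ⟨hD, fun P => ?_⟩
  have h1 := le_divisorDegree (F := F) hD P
  have h2 : (0 : ℤ) < P.degree F := by exact_mod_cast P.degree_pos F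
  have h3 : 0 ≤ D P := hD P
  change D P ≤ if P ∈ hT.toFinset then n else 0
  rw [hdeg] at h1
  split_ifs with hP
  · nlinarith
  · by_contra! h4
    exact hP (hT.mem_toFinset.2 (show (P.degree F : ℤ) ≤ n by nlinarith))

/-- If deg D₀ > γ in Riemann's inequality and deg D = 0, then L(D + D₀) contains some f ≠ 0. So D is
equivalent to E - D₀ with E = D + D₀ + div f effective of degree deg D₀. -/
theorem finite_pic0 : Finite (Pic0 F K) := by
  obtain ⟨γ, hγ⟩ := exists_divisorDegree_le_riemannRochDim_add F K
  obtain ⟨D₀, hD₀⟩ : ∃ D₀ : Divisor K, γ < divisorDegree F D₀ := by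
    obtain ⟨x, hx⟩ := IsFunctionFieldOver.exists_transcendental (F := F) (K := K)
    have := IsFunctionFieldOver.finite_adjoin x hx
    have hn : (0 : ℤ) < finrank F⟮x⟯ K := by exact_mod_cast finrank_pos (R := F⟮x⟯) (M := K)
    obtain ⟨B, hB⟩ := exists_zeroDivisor F x⁻¹
    refine ⟨(γ.toNat + 1) • B, ?_⟩
    rw [map_nsmul, divisorDegree_poleDivisor hx hB, nsmul_eq_mul]
    push_cast
    have := Int.self_le_toNat γ
    nlinarith
  refine (((finite_setOf_effective_divisorDegree_eq F K (divisorDegree F D₀)).image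
    fun E => QuotientAddGroup.mk' (principalDivisors K) (E - D₀)).subset ?_).to_subtype
  rintro _ ⟨D, hD, rfl⟩
  have hD' : divisorDegree F D = 0 := hD
  have hpos : riemannRochSpace F (D + D₀) ≠ ⊥ := by
    intro h
    have := hγ (D + D₀)
    rw [riemannRochDim, h, finrank_bot, map_add, hD'] at this
    push_cast at this
    linarith
  obtain ⟨f, hf, hf0⟩ := Submodule.exists_mem_ne_zero_of_ne_bot hpos
  obtain ⟨G, hG⟩ := exists_hasDivisor F hf0
  refine ⟨D + D₀ + G, ⟨fun P => ?_, ?_⟩, ?_⟩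
  · have := hf hf0 P
    rw [hG.2 P] at this
    rw [Finsupp.add_apply (D + D₀), Finsupp.zero_apply]
    omega
  · rw [map_add, map_add, hD', hG.divisorDegree_eq_zero]; ring
  · refine (QuotientAddGroup.eq (s := principalDivisors K)).2 ?_
    rw [show -(D + D₀ + G - D₀) + D = -G by abel]
    exact neg_mem (show G ∈ principalDivisors K from ⟨f, hG⟩)

end Finiteness

/-! ### The Las Vegas algorithm -/

section Algorithm
variable {F K : Type*} [Field F] [Finite F] [Field K] [Algebra F K]

theorem isSingular_algebraMap {c : F} (hc : c ≠ 0) : IsSingular (algebraMap F K c) :=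
  ⟨(map_ne_zero _).2 hc, fun P => by rw [P.ord_algebraMap F c]; exact Even.zero⟩

theorem divisorDegree_nsmul_sub_nsmul {p q : Place K} (hpq : p.degree F = q.degree F) (k : ℕ) :
    divisorDegree F (k • p.toDivisor - k • q.toDivisor) = 0 := by
  rw [map_sub, map_nsmul, map_nsmul, divisorDegree_toDivisor, divisorDegree_toDivisor, hpq,
    sub_self]

variable [IsFunctionFieldOver F K]

/-- A nonzero element of the Riemann-Roch space of a divisor of degree zero has the opposite
divisor. -/
theorem hasDivisor_neg_of_mem_riemannRochSpace {D : Divisor K} (hD : divisorDegree F D = 0) {f : K}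
    (hf0 : f ≠ 0) (hf : f ∈ riemannRochSpace F D) : HasDivisor f (-D) := by
  obtain ⟨G, hG⟩ := exists_hasDivisor F hf0
  have h0 : D + G = 0 := by
    refine eq_zero_of_divisorDegree_eq_zero (F := F) (fun P => ?_) ?_
    · have := hf hf0 P
      rw [hG.2 P] at this
      rw [Finsupp.add_apply, Finsupp.zero_apply]
      omega
    · rw [map_add, hD, hG.divisorDegree_eq_zero, add_zero]
  rwa [neg_eq_of_add_eq_zero_right h0]

/-- Any two nonzero elements have the same divisor -D, so their quotient is constant. -/
theorem span_singleton_eq_riemannRochSpace {D : Divisor K} (hD : divisorDegree F D = 0) {f : K}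
    (hf0 : f ≠ 0) (hf : f ∈ riemannRochSpace F D) :
    Submodule.span F {f} = riemannRochSpace F D := by
  refine le_antisymm ((Submodule.span_singleton_le_iff_mem _ _).2 hf) fun g hg => ?_
  rw [Submodule.mem_span_singleton]
  by_cases hg0 : g = 0
  · exact ⟨0, by rw [hg0, zero_smul]⟩
  have h1 := hasDivisor_neg_of_mem_riemannRochSpace hD hf0 hf
  have h2 := hasDivisor_neg_of_mem_riemannRochSpace hD hg0 hg
  obtain ⟨c, hc⟩ := mem_range_of_forall_ord_nonneg F (f := g * f⁻¹) fun P => by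
    rw [P.ord_mul hg0 (inv_ne_zero hf0), P.ord_inv, h1.2, h2.2, add_neg_cancel]
  refine ⟨c, ?_⟩
  rw [Algebra.smul_def, hc, mul_assoc, inv_mul_cancel₀ hf0, mul_one]

variable {p q : Place K}

/-- The class of q - p has finite order n in Pic⁰, and a function with divisor n(q - p) lies in L(np
- nq). -/
theorem exists_isMinExponent (hpq : p.degree F = q.degree F) : ∃ k, IsMinExponent F p q k := by
  classical
  have hfin := finite_pic0 F K
  have hmem : QuotientAddGroup.mk' (principalDivisors K) (q.toDivisor - p.toDivisor) ∈ Pic0 F K :=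
    ⟨_, by simpa using divisorDegree_nsmul_sub_nsmul hpq.symm 1, rfl⟩
  obtain ⟨n, hn, h⟩ := isOfFinAddOrder_iff_nsmul_eq_zero.1
    (isOfFinAddOrder_of_finite (⟨_, hmem⟩ : Pic0 F K))
  have h0 : QuotientAddGroup.mk' (principalDivisors K) (n • (q.toDivisor - p.toDivisor)) = 0 := by
    rw [map_nsmul]
    exact congrArg Subtype.val h
  obtain ⟨f, hf⟩ : n • (q.toDivisor - p.toDivisor) ∈ principalDivisors K :=
    (QuotientAddGroup.eq_zero_iff _).1 h0
  have hex : ∃ j : ℕ, 1 ≤ j ∧ riemannRochSpace F (j • p.toDivisor - j • q.toDivisor) ≠ ⊥ := by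
    refine ⟨n, hn, (Submodule.ne_bot_iff _).2 ⟨f, fun _ P => ?_, hf.1⟩⟩
    rw [hf.2 P, smul_sub, ← Finsupp.neg_apply, neg_sub]
  exact ⟨Nat.find hex, Nat.find_spec hex, fun j hj => Nat.find_min' hex hj⟩

theorem GeneratesRR.hasDivisor (hpq : p.degree F = q.degree F) {k : ℕ}
    (hk : IsMinExponent F p q k) {β : K}
    (hβ : GeneratesRR F (k • p.toDivisor - k • q.toDivisor) β) :
    HasDivisor β (k • q.toDivisor - k • p.toDivisor) := by
  have hβ0 : β ≠ 0 := by
    rintro rfl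
    exact hk.1.2 (by rw [← hβ, Submodule.span_zero_singleton])
  have hmem : β ∈ riemannRochSpace F (k • p.toDivisor - k • q.toDivisor) :=
    hβ ▸ Submodule.mem_span_singleton_self β
  have := hasDivisor_neg_of_mem_riemannRochSpace (divisorDegree_nsmul_sub_nsmul hpq k) hβ0 hmem
  rwa [neg_sub] at this

theorem GeneratesRR.isSingular (hpq : p.degree F = q.degree F) {k : ℕ}
    (hk : IsMinExponent F p q k) (hev : Even k) {β : K}
    (hβ : GeneratesRR F (k • p.toDivisor - k • q.toDivisor) β) : IsSingular β := by
  have h := GeneratesRR.hasDivisor hpq hk hβ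
  refine ⟨h.1, fun P => ?_⟩
  rw [h.2 P, ← smul_sub, Finsupp.smul_apply, nsmul_eq_mul]
  exact Even.mul_right (by exact_mod_cast hev) _

theorem exists_generatesRR (hpq : p.degree F = q.degree F) {k : ℕ}
    (hk : IsMinExponent F p q k) :
    ∃ β : K, β ≠ 0 ∧ GeneratesRR F (k • p.toDivisor - k • q.toDivisor) β := by
  obtain ⟨β, hβ, hβ0⟩ := Submodule.exists_mem_ne_zero_of_ne_bot hk.1.2
  exact ⟨β, hβ0,
    span_singleton_eq_riemannRochSpace (divisorDegree_nsmul_sub_nsmul hpq k) hβ0 hβ⟩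

end Algorithm
end GlobalFunctionField
end

theorem mainTheorem4 {F K : Type*} [Field F] [Finite F] [Field K]
    [Algebra F K] [Algebra (RatFunc F) K] [IsScalarTower F (RatFunc F) K]
    (hodd : ringChar F ≠ 2)
    (hfun : FunctionField F K)
    (hconst : algebraicClosure F K = ⊥) :
    Finite (GlobalFunctionField.Pic0 F K) ∧
    (∃ ζ : F, ¬ IsSquare ζ) ∧
    ∀ p q : GlobalFunctionField.Place K, p.degree F = q.degree F →
      (∃ k : ℕ, GlobalFunctionField.IsMinExponent F p q k ∧
        Module.finrank F (GlobalFunctionField.riemannRochSpace F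
          (k • p.toDivisor - k • q.toDivisor)) = 1 ∧
        ∀ β : K, GlobalFunctionField.GeneratesRR F (k • p.toDivisor - k • q.toDivisor) β →
          GlobalFunctionField.HasDivisor β (k • q.toDivisor - k • p.toDivisor) ∧
          (Even k → GlobalFunctionField.IsSingular β)) ∧
      (∃ β : K, GlobalFunctionField.LasVegasOutput F p q β) ∧
      ∀ β : K, GlobalFunctionField.LasVegasOutput F p q β → GlobalFunctionField.IsSingular β := by
  have := GlobalFunctionField.isFunctionFieldOver F K hconst
  refine ⟨GlobalFunctionField.finite_pic0 F K, FiniteField.exists_nonsquare hodd,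
    fun p q hpq => ?_⟩
  obtain ⟨k, hk⟩ := GlobalFunctionField.exists_isMinExponent hpq
  obtain ⟨β, hβ0, hβ⟩ := GlobalFunctionField.exists_generatesRR hpq hk
  refine ⟨⟨k, hk, ?_, fun β hβ => ⟨GlobalFunctionField.GeneratesRR.hasDivisor hpq hk hβ,
    fun hev => GlobalFunctionField.GeneratesRR.isSingular hpq hk hev hβ⟩⟩, ?_, fun β hβ => ?_⟩
  · rw [← show Submodule.span F {β} = _ from hβ]
    exact finrank_span_singleton hβ0
  · by_cases hev : Even k
    · exact ⟨β, .generator k hk hev β hβ⟩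
    · exact ⟨1, .one k hk hev⟩
  · cases hβ with
    | generator k hk hev β hβ => exact GlobalFunctionField.GeneratesRR.isSingular hpq hk hev hβ
    | nonsquare k hk hodd ζ hζ =>
      refine GlobalFunctionField.isSingular_algebraMap ?_
      -- Zero is a square, so a non-square constant is nonzero.
      rintro rfl
      exact hζ IsSquare.zero
    | one k hk hodd =>
      have := GlobalFunctionField.isSingular_algebraMap (F := F) (K := K) one_ne_zero
      rwa [map_one] at this
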